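/- Let $d\in\mathbb N$ and $\mathbb T^d=(\mathbb R/2\pi\mathbb Z)^d$, let $\varphi_k(x)=(2\pi)^{-d/2}e^{ik\cdot x}$ for $k\in\mathbb Z^d$, let $L^2=L^2(\mathbb T^d,\mathbb R)$, and let $H^1=\{f\in L^2:\sum_{k}|k|^2|\langle f,\varphi_k\rangle|^2<\infty\}$ with $\|f\|_{H^1}^2=\|f\|_{L^2}^2+\sum_k|k|^2|\langle f,\varphi_k\rangle|^2$. Set $(\mu_0,\dots,\mu_{2d})=(1,\cos x_1,\sin x_1,\dots,\cos x_d,\sin x_d)$ and consider the bilinear wave equation $$\partial_t^2 w(x,t)=\Big(\Delta+\sum_{j=0}^{2d}p_j(t)\mu_j(x)\Big)w(x,t),\qquad x\in\mathbb T^d,$$ with control $p=(p_0,\dots,p_{2d})$. Its solution on $[0,T]$ with initial state $(w_0,\dot w_0)\in H^1\times L^2$ is the function $W=(w,\partial_t w)\in C^0([0,T],H^1\times L^2)$ such that, for all $t\in[0,T]$, $$W(t)=e^{t\mathcal A}(w_0,\dot w_0)+\int_0^t e^{(t-s)\mathcal A}\Big(0,\ \sum_{j=0}^{2d}p_j(s)\mu_j\,w(s)\Big)\,ds,$$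 where $e^{t\mathcal A}$ is the group generated by $\mathcal A=\begin{pmatrix}0&I\\ \Delta&0\end{pmatrix}$ on $H^1\times L^2$, that is, the solution operator of the free wave equation. Let $(0,0)\neq(w_0,\dot w_0)\in H^1\times L^2$ be such that either $w_0\neq0$ and $\langle w_0,e^{ik\cdot x}\rangle_{L^2}=0$ for all but finitely many $k\in\mathbb Z^d$, or $w_0=0$, $\dot w_0\neq0$ and $\langle\dot w_0,e^{ik\cdot x}\rangle_{L^2}=0$ for all but finitely many $k\in\mathbb Z^d$. Then for every $(w_1,\dot w_1)\in H^1\times L^2$, every $\varepsilon>0$ and every $T>0$ there is a piecewise constant control $p:[0,T]\to\mathbb R^{2d+1}$ for which the solution $(w,\partial_t w)$ on $[0,T]$ with initial state $(w_0,\dot w_0)$ exists, is unique, and satisfies $$\big\|(w(T),\partial_t w(T))-(w_1,\dot w_1)\big\|_{H^1\times L^2}<\varepsilon .$$ -/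

import Mathlib

open MeasureTheory Set
open scoped ENNReal ComplexConjugate

noncomputable section

namespace BilinearWave

instance fact_two_pi_pos : Fact (0 < 2 * Real.pi) := ⟨Real.two_pi_pos⟩

/-- The torus `𝕋^d = (ℝ / 2πℤ)^d`; its `volume` is Lebesgue measure, of total mass `(2π)^d`. -/
abbrev Torus (d : ℕ) : Type := Fin d → AddCircle (2 * Real.pi)

/-- The real Hilbert space `L²(𝕋^d, ℝ)`. -/
abbrev L2 (d : ℕ) : Type := Lp ℝ 2 (volume : Measure (Torus d))

/-- The eigenfunctions `φ_k(x) = (2π)^{-d/2} e^{ikx}` of the Laplacian. -/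
def eigenfunction {d : ℕ} (k : Fin d → ℤ) : C(Torus d, ℂ) where
  toFun x := (((2 * Real.pi) ^ (-(d : ℝ) / 2) : ℝ) : ℂ) * ∏ i, fourier (k i) (x i)
  continuous_toFun := by fun_prop

/-- The eigenvalues `λ_k = |k|²` of `-Δ`. -/
def eigenvalue {d : ℕ} (k : Fin d → ℤ) : ℝ := ∑ i, (k i : ℝ) ^ 2

/-- The Fourier coefficient `⟨f, φ_k⟩`, where `⟨f, g⟩ = ∫ f(x) conj(g(x)) dx`. -/
def coeff {d : ℕ} (f : L2 d) (k : Fin d → ℤ) : ℂ :=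
  ∫ x, (f x : ℂ) * conj (eigenfunction k x)

/-- `f` has only finitely many non-vanishing Fourier modes. -/
def HasFinitelyManyModes {d : ℕ} (f : L2 d) : Prop :=
  {k : Fin d → ℤ | coeff f k ≠ 0}.Finite

lemma integrable_coeff {d : ℕ} (f : L2 d) (k : Fin d → ℤ) :
    Integrable (fun x => (f x : ℂ) * conj (eigenfunction k x)) := by
  have hf : Integrable (fun x => (f x : ℂ)) :=
    ((Lp.memLp f).integrable (by norm_num)).ofReal
  refine hf.mul_bdd (c := ‖eigenfunction k‖) ?_ ?_
  · exact (by fun_prop : Continuous fun x => conj (eigenfunction k x)).aestronglyMeasurable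
  · exact Filter.Eventually.of_forall fun x => by
      simpa using (eigenfunction k).norm_coe_le_norm x

lemma coeff_add {d : ℕ} (f g : L2 d) (k : Fin d → ℤ) :
    coeff (f + g) k = coeff f k + coeff g k := by
  unfold coeff
  rw [← integral_add (integrable_coeff f k) (integrable_coeff g k)]
  refine integral_congr_ae ?_
  filter_upwards [Lp.coeFn_add f g] with x hx
  rw [hx]
  simp [add_mul]

lemma coeff_smul {d : ℕ} (c : ℝ) (f : L2 d) (k : Fin d → ℤ) :
    coeff (c • f) k = c * coeff f k := by
  unfold coeff
  rw [← integral_const_mul]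
  refine integral_congr_ae ?_
  filter_upwards [Lp.coeFn_smul c f] with x hx
  rw [hx]
  simp [mul_assoc]

/-- Membership in `H¹(𝕋^d, ℝ)`: the sequence `|k| ⟨f, φ_k⟩` is square summable. -/
def h1Submodule (d : ℕ) : Submodule ℝ (L2 d) where
  carrier := {f | Memℓp (fun k : Fin d → ℤ => (Real.sqrt (eigenvalue k) : ℂ) * coeff f k) 2}
  zero_mem' := by
    have h : ∀ k, coeff (0 : L2 d) k = 0 := fun k => by
      simpa using coeff_smul 0 (0 : L2 d) k
    refine cast (congrArg (fun u => Memℓp u 2) ?_)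
      (zero_memℓp : Memℓp (0 : (k : Fin d → ℤ) → ℂ) 2)
    funext k
    simp [h]
  add_mem' := by
    intro f g hf hg
    have h := Memℓp.add hf hg
    refine cast (congrArg (fun u => Memℓp u 2) ?_) h
    funext k
    simp [coeff_add, mul_add]
  smul_mem' := by
    intro c f hf
    have h := Memℓp.const_smul hf (c : ℂ)
    refine cast (congrArg (fun u => Memℓp u 2) ?_) h
    funext k
    simp only [Pi.smul_apply, smul_eq_mul, coeff_smul]
    ring

/-- The membership condition is the usual one, `∑ λ_k |⟨f, φ_k⟩|² < ∞`. -/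
lemma mem_h1Submodule_iff {d : ℕ} (f : L2 d) :
    f ∈ h1Submodule d ↔ Summable fun k : Fin d → ℤ => eigenvalue k * ‖coeff f k‖ ^ 2 := by
  change Memℓp _ 2 ↔ _
  rw [memℓp_gen_iff (by norm_num)]
  refine summable_congr fun k => ?_
  have hk : 0 ≤ eigenvalue k := Finset.sum_nonneg fun i _ => sq_nonneg _
  simp [mul_pow, Real.sq_sqrt hk]

/-- The Sobolev space `H¹(𝕋^d, ℝ)`, with the norm introduced below. -/
def H1 (d : ℕ) : Type := h1Submodule d

instance (d : ℕ) : AddCommGroup (H1 d) := inferInstanceAs (AddCommGroup (h1Submodule d))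

instance (d : ℕ) : Module ℝ (H1 d) := inferInstanceAs (Module ℝ (h1Submodule d))

/-- The inclusion `H¹ ⊆ L²`. -/
def toL2 {d : ℕ} : H1 d →ₗ[ℝ] L2 d := (h1Submodule d).subtype

/-- The square summable sequence `|k| ⟨f, φ_k⟩`. -/
def gradCoeff {d : ℕ} : H1 d →ₗ[ℝ] lp (fun _ : Fin d → ℤ => ℂ) 2 where
  toFun f := ⟨fun k => (Real.sqrt (eigenvalue k) : ℂ) * coeff (toL2 f) k, f.2⟩
  map_add' f g := by
    ext k
    simp only [map_add, coeff_add, mul_add]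
    rfl
  map_smul' c f := by
    ext k
    simp only [map_smul, coeff_smul, RingHom.id_apply, lp.coeFn_smul, Pi.smul_apply,
      Complex.real_smul]
    ring

/-- The map `f ↦ (f, (|k| ⟨f, φ_k⟩)_k)`, through which `H¹` is normed. -/
def h1Embedding {d : ℕ} : H1 d →ₗ[ℝ] WithLp 2 (L2 d × lp (fun _ : Fin d → ℤ => ℂ) 2) :=
  (WithLp.linearEquiv 2 ℝ (L2 d × lp (fun _ : Fin d → ℤ => ℂ) 2)).symm.toLinearMap ∘ₗ
    toL2.prod gradCoeff

lemma h1Embedding_injective {d : ℕ} : Function.Injective (h1Embedding (d := d)) := by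
  intro f g h
  have h2 : toL2 f = toL2 g := congrArg (fun z => z.ofLp.1) h
  exact Subtype.ext h2

instance (d : ℕ) : NormedAddCommGroup (H1 d) :=
  NormedAddCommGroup.induced (H1 d) _ h1Embedding h1Embedding_injective

instance (d : ℕ) : NormedSpace ℝ (H1 d) := NormedSpace.induced ℝ (H1 d) _ h1Embedding

/-- `‖f‖²_{H¹} = ‖f‖²_{L²} + ∑ λ_k |⟨f, φ_k⟩|²`. -/
lemma H1.norm_sq {d : ℕ} (f : H1 d) :
    ‖f‖ ^ 2 = ‖toL2 f‖ ^ 2 + ∑' k : Fin d → ℤ, eigenvalue k * ‖coeff (toL2 f) k‖ ^ 2 := by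
  have h : ‖f‖ ^ 2 = ‖h1Embedding f‖ ^ 2 := rfl
  rw [h, WithLp.prod_norm_sq_eq_of_L2]
  congr 1
  have h2 : ‖gradCoeff f‖ ^ 2 = ∑' k, ‖gradCoeff f k‖ ^ 2 := by
    simpa using lp.norm_rpow_eq_tsum (p := 2) (by norm_num) (gradCoeff f)
  refine h2.trans (tsum_congr fun k => ?_)
  have hk : 0 ≤ eigenvalue k := Finset.sum_nonneg fun i _ => sq_nonneg _
  simp [gradCoeff, mul_pow, Real.sq_sqrt hk]

/-- The real function `Re (a φ_k)`. -/
def modeFun {d : ℕ} (a : ℂ) (k : Fin d → ℤ) : C(Torus d, ℝ) where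
  toFun x := (a * eigenfunction k x).re
  continuous_toFun := by fun_prop

/-- `Re (a φ_k)` as an element of `L²`. -/
def modeL2 {d : ℕ} (a : ℂ) (k : Fin d → ℤ) : L2 d := ContinuousMap.toLp 2 volume ℝ (modeFun a k)

lemma coeff_eq_inner {d : ℕ} (f : L2 d) (k : Fin d → ℤ) :
    coeff f k = (inner ℝ (modeL2 1 k) f : ℝ) -
      Complex.I * (inner ℝ (modeL2 (-Complex.I) k) f : ℝ) := by
  have hm : ∀ a : ℂ, (inner ℝ (modeL2 a k) f : ℝ) =
      ((∫ x, f x * (a * eigenfunction k x).re) : ℝ) := by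
    intro a
    rw [L2.inner_def]
    refine integral_congr_ae ?_
    filter_upwards [ContinuousMap.coeFn_toLp (𝕜 := ℝ) (p := 2) volume (modeFun a k)] with x hx
    have hx' : (modeL2 a k) x = (a * eigenfunction k x).re := hx
    simp [hx']
  have hi := integrable_coeff f k
  rw [hm, hm]
  apply Complex.ext
  · have := integral_re hi
    simp only [RCLike.re_eq_complex_re] at this
    simp [coeff, ← this]
  · have := integral_im hi
    simp only [RCLike.im_eq_complex_im] at this
    simp [coeff, ← this, integral_neg]

lemma continuous_coeff {d : ℕ} (k : Fin d → ℤ) : Continuous fun f : L2 d => coeff f k := by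
  simp_rw [coeff_eq_inner]
  fun_prop

/-- `H¹` is complete, so that Bochner integrals in `H¹ × L²` have their usual meaning. -/
instance (d : ℕ) : CompleteSpace (H1 d) := by
  have hu : IsUniformInducing (h1Embedding (d := d)) := ⟨rfl⟩
  rw [completeSpace_iff_isComplete_range hu]
  apply IsClosed.isComplete
  have hr : Set.range (h1Embedding (d := d)) =
      {z | ∀ k, z.snd k = (Real.sqrt (eigenvalue k) : ℂ) * coeff z.fst k} := by
    ext z
    constructor
    · rintro ⟨f, rfl⟩ k
      rfl
    · intro hz
      have hz' : z.fst ∈ h1Submodule d := by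
        change Memℓp _ 2
        rw [← funext hz]
        exact lp.memℓp z.snd
      refine ⟨⟨z.fst, hz'⟩, ?_⟩
      apply (WithLp.linearEquiv 2 ℝ (L2 d × lp (fun _ : Fin d → ℤ => ℂ) 2)).injective
      refine Prod.ext rfl ?_
      ext k
      exact (hz k).symm
  rw [hr, Set.ofPred_forall]
  refine isClosed_iInter fun k => isClosed_eq ?_ ?_
  · have h1 : Continuous fun y : lp (fun _ : Fin d → ℤ => ℂ) 2 => y k :=
      (lp.evalCLM ℂ (fun _ : Fin d → ℤ => ℂ) 2 k).continuous
    exact h1.comp (WithLp.prod_continuous_ofLp 2 _ _).snd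
  · exact continuous_const.mul ((continuous_coeff k).comp (WithLp.prod_continuous_ofLp 2 _ _).fst)

/-- The state space `H¹ × L²(𝕋^d, ℝ)` of pairs (profile, velocity). -/
abbrev State (d : ℕ) : Type := H1 d × L2 d

/-- The Hilbert norm of `H¹ × L²`. -/
def stateNorm {d : ℕ} (W : State d) : ℝ := Real.sqrt (‖W.1‖ ^ 2 + ‖W.2‖ ^ 2)

lemma integral_prod_fourier {d : ℕ} (n : Fin d → ℤ) (hn : n ≠ 0) :
    ∫ x : Torus d, ∏ i, (fourier (n i) (x i) : ℂ) = 0 := by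
  obtain ⟨i, hi⟩ := Function.ne_iff.mp hn
  rw [integral_fintype_prod_volume_eq_prod (fun i (y : AddCircle (2 * Real.pi)) =>
    (fourier (n i) y : ℂ))]
  exact Finset.prod_eq_zero (Finset.mem_univ i)
    (integral_eq_zero_of_add_right_eq_neg (fourier_add_half_inv_index hi Real.two_pi_pos))

lemma coeff_modeL2 {d : ℕ} (a : ℂ) (k j : Fin d → ℤ) (h1 : j ≠ k) (h2 : j ≠ -k) :
    coeff (modeL2 a k) j = 0 := by
  set r : ℂ := (((2 * Real.pi) ^ (-(d : ℝ) / 2) : ℝ) : ℂ) with hr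
  have e : ∀ x : Torus d, (((a * eigenfunction k x).re : ℝ) : ℂ) * conj (eigenfunction j x) =
      a * r ^ 2 / 2 * ∏ i, (fourier ((k - j) i) (x i) : ℂ) +
        conj a * r ^ 2 / 2 * ∏ i, (fourier ((-k - j) i) (x i) : ℂ) := by
    intro x
    have hc : conj r = r := Complex.conj_ofReal _
    rw [Complex.re_eq_add_conj]
    simp only [eigenfunction, ContinuousMap.coe_mk, map_mul, map_prod, ← hr, hc, ← fourier_neg,
      Pi.sub_apply, Pi.neg_apply, sub_eq_add_neg, fourier_add, Finset.prod_mul_distrib]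
    ring
  have hi : ∀ n : Fin d → ℤ, Integrable fun x : Torus d => ∏ i, (fourier (n i) (x i) : ℂ) :=
    fun n => (by fun_prop : Continuous fun x : Torus d =>
      ∏ i, (fourier (n i) (x i) : ℂ)).integrable_of_hasCompactSupport
        (HasCompactSupport.of_compactSpace _)
  have hx : coeff (modeL2 a k) j =
      ∫ x : Torus d, (((a * eigenfunction k x).re : ℝ) : ℂ) * conj (eigenfunction j x) := by
    refine integral_congr_ae ?_
    filter_upwards [ContinuousMap.coeFn_toLp (𝕜 := ℝ) (p := 2) volume (modeFun a k)] with x hx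
    have hx' : (modeL2 a k) x = (a * eigenfunction k x).re := hx
    simp only [hx']
  rw [hx, integral_congr_ae (Filter.Eventually.of_forall e),
    integral_add ((hi _).const_mul _) ((hi _).const_mul _), integral_const_mul,
    integral_const_mul, integral_prod_fourier _ (sub_ne_zero.mpr (Ne.symm h1)),
    integral_prod_fourier _ (sub_ne_zero.mpr (Ne.symm h2))]
  simp

/-- `Re (a φ_k)` as an element of `H¹`. -/
def modeH1 {d : ℕ} (a : ℂ) (k : Fin d → ℤ) : H1 d :=
  ⟨modeL2 a k, by
    rw [mem_h1Submodule_iff]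
    refine summable_of_ne_finset_zero (s := {k, -k}) fun j hj => ?_
    simp only [Finset.mem_insert, Finset.mem_singleton, not_or] at hj
    simp [coeff_modeL2 a k j hj.1 hj.2]⟩

/-- The free evolution `e^{t𝒜}`, `𝒜 (w, v) = (v, Δ w)`, through its Fourier series. The factor
`t * sinc (√λ t)` is `sin (√λ t) / √λ` for `λ ≠ 0` and `t` for `λ = 0`. As `w` and `v` are
real-valued, the terms of index `k` and `-k` are conjugate, so that taking real parts does not
change the sums. The series converge in `H¹` and in `L²`. -/
def freeEvolution {d : ℕ} (t : ℝ) (W : State d) : State d :=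
  (∑' k : Fin d → ℤ, modeH1
      (coeff (toL2 W.1) k * (Real.cos (Real.sqrt (eigenvalue k) * t) : ℝ) +
        coeff W.2 k * (t * Real.sinc (Real.sqrt (eigenvalue k) * t) : ℝ)) k,
    ∑' k : Fin d → ℤ, modeL2
      (-(Real.sqrt (eigenvalue k) : ℝ) * coeff (toL2 W.1) k *
          (Real.sin (Real.sqrt (eigenvalue k) * t) : ℝ) +
        coeff W.2 k * (Real.cos (Real.sqrt (eigenvalue k) * t) : ℝ)) k)

/-- The control modes `(μ_0, …, μ_{2d}) = (1, cos x_1, sin x_1, …, cos x_d, sin x_d)`. -/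
def controlMode {d : ℕ} (j : Fin (2 * d + 1)) : C(Torus d, ℝ) :=
  Fin.cases 1 (fun m : Fin (2 * d) =>
    let i : Fin d := ⟨m.val / 2, by omega⟩
    if m.val % 2 = 0 then
      ⟨fun x => Real.Angle.cos (x i), Real.Angle.continuous_cos.comp (continuous_apply i)⟩
    else
      ⟨fun x => Real.Angle.sin (x i), Real.Angle.continuous_sin.comp (continuous_apply i)⟩) j

/-- The potential `∑_j p_j μ_j(x)` for given control values `p_j`. -/
def potential {d : ℕ} (p : Fin (2 * d + 1) → ℝ) : C(Torus d, ℝ) := ∑ j, p j • controlMode j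

/-- Multiplication of an `L²` function by a continuous function. -/
def mulL2 {d : ℕ} (V : C(Torus d, ℝ)) (f : L2 d) : L2 d :=
  MemLp.toLp (fun x => V x * f x) ((Lp.memLp f).of_le_mul (c := ‖V‖)
    (V.continuous.aestronglyMeasurable.mul (Lp.aestronglyMeasurable f))
    (Filter.Eventually.of_forall fun x => by
      rw [norm_mul]
      exact mul_le_mul_of_nonneg_right (V.norm_coe_le_norm x) (norm_nonneg _)))

/-- The bounded operator `(w, v) ↦ (0, V w)`, that is, `V ℬ`. -/
def controlOp {d : ℕ} (V : C(Torus d, ℝ)) (W : State d) : State d := (0, mulL2 V (toL2 W.1))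

/-- `W = (w, ∂_t w)` solves `∂_t² w = (Δ + ∑_j p_j(t) μ_j(x)) w` on `[0, T]` with `W(0) = W₀`:
it is continuous into `H¹ × L²` and satisfies the Duhamel formula there. -/
def IsSolution {d : ℕ} (T : ℝ) (p : ℝ → Fin (2 * d + 1) → ℝ) (W₀ : State d) (W : ℝ → State d) :
    Prop :=
  ContinuousOn W (Icc 0 T) ∧
  ∀ t ∈ Icc (0 : ℝ) T,
    IntervalIntegrable (fun s => freeEvolution (t - s) (controlOp (potential (p s)) (W s)))
      volume 0 t ∧
    W t = freeEvolution t W₀ +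
      ∫ s in (0 : ℝ)..t, freeEvolution (t - s) (controlOp (potential (p s)) (W s))

/-- `p` is piecewise constant on `[0, T]`: it is constant on the intervals `[t_i, t_{i+1})` of a
subdivision `0 = t_0 < … < t_N = T`. -/
def IsPiecewiseConstant {X : Type*} (T : ℝ) (p : ℝ → X) : Prop :=
  ∃ (N : ℕ) (t : Fin (N + 1) → ℝ), StrictMono t ∧ t 0 = 0 ∧ t (Fin.last N) = T ∧
    ∀ i : Fin N, ∃ c, ∀ s ∈ Ico (t i.castSucc) (t i.succ), p s = c

end BilinearWave

end

open BilinearWave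

/-!
A constant control of size `1 / δ` applied for a time `δ → 0` acts as the impulse
`(w, v) ↦ (w, v + φ w)`, with `φ` any combination of the `μⱼ`. Conjugating the free evolution over a
time `δ` by the impulses of `φ / √δ` and `-φ / √δ` produces the impulse of `-φ²` in the limit, so
the potentials with small-time impulses are closed under sums and, up to sign, under squares; by
the addition formulas they contain every trigonometric polynomial. A nonzero trigonometric
polynomial `w` vanishes only on a null set, hence the products `φ w` are dense in `L²` and impulses
move the velocity to any target. With its initial velocity chosen suitably, the free evolution moves
one profile with finitely many modes to another. So every state is approached in arbitrarily small
time, and to reach `(w₁, v₁)` at time `T` one first approaches its preimage under the free evolution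
and then lets the wave evolve freely.
-/

noncomputable section

namespace BilinearWave

variable {d : ℕ}

/-! ### Mild solutions of bounded perturbations of a strongly continuous group -/

/-- A strongly continuous one-parameter group of bounded operators. Local boundedness is part of
the definition, although in a Banach space it follows from the other properties. -/
structure IsStronglyContinuousGroup {E : Type*} [NormedAddCommGroup E] [NormedSpace ℝ E]
    (U : ℝ → E →L[ℝ] E) : Prop where
  zero_apply : ∀ x, U 0 x = x
  add_apply : ∀ s t x, U (s + t) x = U s (U t x)
  continuous_apply : ∀ x, Continuous fun t => U t x
  bounded : ∀ T : ℝ, ∃ M, 0 ≤ M ∧ ∀ t, |t| ≤ T → ‖U t‖ ≤ M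

/-- `y` is the value at time `t` of the solution of `W' = 𝒜 W + f`, `W(0) = x`, in the sense of
Duhamel, where `𝒜` is the generator of `U`. -/
def IsDuhamelValue {E : Type*} [NormedAddCommGroup E] [NormedSpace ℝ E] (U : ℝ → E →L[ℝ] E)
    (f : ℝ → E) (t : ℝ) (x y : E) : Prop :=
  IntervalIntegrable (fun s => U (t - s) (f s)) volume 0 t ∧
    y = U t x + ∫ s in (0 : ℝ)..t, U (t - s) (f s)

/-- `W` is the mild solution on `[0, T]` of `W' = (𝒜 + K(t)) W`, `W(0) = x`, where `𝒜` is the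
generator of `U`. -/
def IsMildSolution {E : Type*} [NormedAddCommGroup E] [NormedSpace ℝ E] (U : ℝ → E →L[ℝ] E)
    (K : ℝ → E →L[ℝ] E) (T : ℝ) (x : E) (W : ℝ → E) : Prop :=
  ContinuousOn W (Icc 0 T) ∧
    ∀ t ∈ Icc (0 : ℝ) T, IsDuhamelValue U (fun s => K s (W s)) t x (W t)

lemma le_mul_exp_of_le_add_integral {g : ℝ → ℝ} {T a C : ℝ} (hT : 0 ≤ T) (hC : 0 ≤ C)
    (hg : ContinuousOn g (Icc 0 T)) (hg0 : ∀ t ∈ Icc 0 T, 0 ≤ g t)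
    (h : ∀ t ∈ Icc 0 T, g t ≤ a + C * ∫ s in (0 : ℝ)..t, g s) :
    ∀ t ∈ Icc 0 T, g t ≤ a * Real.exp (C * t) := by
  set G : ℝ → ℝ := IccExtend hT ((Icc 0 T).domRestrict g)
  have hGc : Continuous G := (continuousOn_iff_continuous_domRestrict.mp hg).Icc_extend'
  have hGg : ∀ t ∈ Icc 0 T, G t = g t := fun t ht => IccExtend_of_mem hT _ ht
  set H : ℝ → ℝ := fun t => a + C * ∫ s in (0 : ℝ)..t, G s with hH
  have hderiv : ∀ t, HasDerivAt H (C * G t) t := fun t =>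
    ((hGc.integral_hasStrictDerivAt 0 t).hasDerivAt.const_mul C).const_add a
  have hle : ∀ t ∈ Icc 0 T, g t ≤ H t := fun t ht => by
    have hGint : ∫ s in (0 : ℝ)..t, G s = ∫ s in (0 : ℝ)..t, g s :=
      intervalIntegral.integral_congr fun s hs => by
        rw [uIcc_of_le ht.1] at hs
        exact hGg s ⟨hs.1, hs.2.trans ht.2⟩
    simpa only [hH, hGint] using h t ht
  have hH0 : H 0 = a := by simp [hH]
  have ha : 0 ≤ a := hH0 ▸ (hg0 0 ⟨le_rfl, hT⟩).trans (hle 0 ⟨le_rfl, hT⟩)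
  have hbound := norm_le_gronwallBound_of_norm_deriv_right_le (δ := a) (K := C) (ε := 0)
    (fun t _ => (hderiv t).continuousAt.continuousWithinAt)
    (fun t _ => (hderiv t).hasDerivWithinAt) (by rw [hH0, Real.norm_of_nonneg ha])
    fun t ht => by
      have ht' : t ∈ Icc 0 T := Ico_subset_Icc_self ht
      rw [hGg t ht', Real.norm_of_nonneg (mul_nonneg hC (hg0 t ht')), add_zero]
      exact mul_le_mul_of_nonneg_left ((hle t ht').trans (le_abs_self _)) hC
  intro t ht
  have hHt := hbound t ht
  rw [gronwallBound_ε0, sub_zero] at hHt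
  exact (hle t ht).trans ((le_abs_self _).trans hHt)

section Group

open Filter Topology

variable {E : Type*} [NormedAddCommGroup E] [NormedSpace ℝ E] {U : ℝ → E →L[ℝ] E}

lemma IsStronglyContinuousGroup.neg_apply_self (hU : IsStronglyContinuousGroup U) (t : ℝ) (x : E) :
    U t (U (-t) x) = x := by
  rw [← hU.add_apply, add_neg_cancel, hU.zero_apply]

lemma IsStronglyContinuousGroup.continuous_uncurry (hU : IsStronglyContinuousGroup U) :
    Continuous fun p : ℝ × E => U p.1 p.2 := by
  refine continuous_iff_continuousAt.mpr fun ⟨t₀, x₀⟩ => ?_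
  obtain ⟨M, -, hM⟩ := hU.bounded (|t₀| + 1)
  refine tendsto_iff_norm_sub_tendsto_zero.mpr ?_
  have hlim : Tendsto (fun p : ℝ × E => M * ‖p.2 - x₀‖ + ‖U p.1 x₀ - U t₀ x₀‖) (𝓝 (t₀, x₀))
      (𝓝 0) := by
    have hx₀ := hU.continuous_apply x₀
    have hcont : Continuous fun p : ℝ × E => M * ‖p.2 - x₀‖ + ‖U p.1 x₀ - U t₀ x₀‖ := by fun_prop
    simpa using hcont.tendsto (t₀, x₀)
  refine squeeze_zero' (Eventually.of_forall fun _ => norm_nonneg _) ?_ hlim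
  have hnear : ∀ᶠ p : ℝ × E in 𝓝 (t₀, x₀), |p.1| < |t₀| + 1 :=
    (by fun_prop : Continuous fun p : ℝ × E => |p.1|).continuousAt.eventually_lt_const
      (lt_add_one _)
  filter_upwards [hnear] with p hp
  calc ‖U p.1 p.2 - U t₀ x₀‖ = ‖U p.1 (p.2 - x₀) + (U p.1 x₀ - U t₀ x₀)‖ := by
        rw [map_sub, sub_add_sub_cancel]
    _ ≤ M * ‖p.2 - x₀‖ + ‖U p.1 x₀ - U t₀ x₀‖ :=
        (norm_add_le _ _).trans (by gcongr; exact (U p.1).le_of_opNorm_le (hM _ hp.le) _)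

lemma norm_integral_group_le {T M t : ℝ} (hM : ∀ t, |t| ≤ T → ‖U t‖ ≤ M) (ht : t ∈ Icc 0 T)
    {f : ℝ → E} {g : ℝ → ℝ} (hfg : ∀ s ∈ Ioc 0 t, ‖f s‖ ≤ g s)
    (hg : IntervalIntegrable g volume 0 t) :
    ‖∫ s in (0 : ℝ)..t, U (t - s) (f s)‖ ≤ M * ∫ s in (0 : ℝ)..t, g s := by
  rw [← intervalIntegral.integral_const_mul]
  refine intervalIntegral.norm_integral_le_of_norm_le ht.1
    (Eventually.of_forall fun s hs => ?_) (hg.const_mul M)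
  have hts : |t - s| ≤ T := by
    rw [abs_of_nonneg (sub_nonneg.mpr hs.2)]
    linarith [hs.1, ht.2]
  exact ((U (t - s)).le_of_opNorm_le_of_le (hM _ hts) (hfg s hs))

lemma IsDuhamelValue.congr_Ioo {f g : ℝ → E} {t : ℝ} {x y : E} (ht : 0 ≤ t)
    (h : IsDuhamelValue U f t x y) (hfg : EqOn f g (Ioo 0 t)) : IsDuhamelValue U g t x y := by
  have hUfg : EqOn (fun s => U (t - s) (f s)) (fun s => U (t - s) (g s)) (Ioo 0 t) :=
    fun s hs => congrArg (U (t - s)) (hfg hs)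
  refine ⟨h.1.congr_uIoo (by rwa [uIoo_of_le ht]), ?_⟩
  rw [h.2, intervalIntegral.integral_congr_Ioo_of_le ht hUfg]

lemma isDuhamelValue_zero_iff (hU : IsStronglyContinuousGroup U) {f : ℝ → E} {x y : E} :
    IsDuhamelValue U f 0 x y ↔ y = x := by
  simp [IsDuhamelValue, hU.zero_apply]

lemma isMildSolution_zero (hU : IsStronglyContinuousGroup U) (K : ℝ → E →L[ℝ] E) (x : E) :
    IsMildSolution U K 0 x fun _ => x := by
  refine ⟨continuousOn_const, fun t ht => ?_⟩
  obtain rfl : t = 0 := le_antisymm ht.2 ht.1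
  exact (isDuhamelValue_zero_iff hU).mpr rfl

lemma IsMildSolution.initial (hU : IsStronglyContinuousGroup U) {K : ℝ → E →L[ℝ] E} {T : ℝ}
    (hT : 0 ≤ T) {x : E} {W : ℝ → E} (hW : IsMildSolution U K T x W) : W 0 = x :=
  (isDuhamelValue_zero_iff hU).mp (hW.2 0 ⟨le_rfl, hT⟩)

lemma IsMildSolution.norm_sub_le_of_approx {K : ℝ → E →L[ℝ] E} {T M κ η : ℝ} {x : E}
    {W Y r : ℝ → E} (hT : 0 ≤ T) (hM : ∀ t, |t| ≤ T → ‖U t‖ ≤ M) (hκ : ∀ s, ‖K s‖ ≤ κ)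
    (hW : IsMildSolution U K T x W) (hYc : ContinuousOn Y (Icc 0 T))
    (hY : ∀ t ∈ Icc 0 T, IsDuhamelValue U (fun s => K s (Y s)) t x (Y t - r t))
    (hr : ∀ t ∈ Icc 0 T, ‖r t‖ ≤ η) :
    ∀ t ∈ Icc 0 T, ‖W t - Y t‖ ≤ η * Real.exp (M * κ * t) := by
  have hM0 : 0 ≤ M := (norm_nonneg _).trans (hM 0 (by rwa [abs_zero]))
  have hκ0 : 0 ≤ κ := (norm_nonneg _).trans (hκ 0)
  have hcont : ContinuousOn (fun t => ‖W t - Y t‖) (Icc 0 T) := (hW.1.sub hYc).norm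
  refine le_mul_exp_of_le_add_integral hT (mul_nonneg hM0 hκ0) hcont (fun _ _ => norm_nonneg _)
    fun t ht => ?_
  obtain ⟨hWi, hWt⟩ := hW.2 t ht
  obtain ⟨hYi, hYt⟩ := hY t ht
  have hdiff : W t - Y t = (∫ s in (0 : ℝ)..t, U (t - s) (K s (W s - Y s))) - r t := by
    simp only [map_sub]
    rw [intervalIntegral.integral_sub hWi hYi, hWt, ← sub_add_cancel (Y t) (r t), hYt]
    abel
  have hint : IntervalIntegrable (fun s => ‖W s - Y s‖) volume 0 t := by
    refine (hcont.mono ?_).intervalIntegrable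
    rw [uIcc_of_le ht.1]
    exact Icc_subset_Icc_right ht.2
  calc ‖W t - Y t‖ ≤ ‖r t‖ + ‖∫ s in (0 : ℝ)..t, U (t - s) (K s (W s - Y s))‖ := by
        rw [hdiff, add_comm]
        exact norm_sub_le _ _
    _ ≤ η + M * ∫ s in (0 : ℝ)..t, κ * ‖W s - Y s‖ :=
        add_le_add (hr t ht) (norm_integral_group_le hM ht
          (fun s _ => (K s).le_of_opNorm_le (hκ s) _) (hint.const_mul κ))
    _ = η + M * κ * ∫ s in (0 : ℝ)..t, ‖W s - Y s‖ := by
        rw [intervalIntegral.integral_const_mul, mul_assoc]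

lemma IsMildSolution.norm_sub_le {K : ℝ → E →L[ℝ] E} {T M κ : ℝ} {x y : E} {V W : ℝ → E}
    (hT : 0 ≤ T) (hM : ∀ t, |t| ≤ T → ‖U t‖ ≤ M) (hκ : ∀ s, ‖K s‖ ≤ κ)
    (hV : IsMildSolution U K T x V) (hW : IsMildSolution U K T y W) :
    ∀ t ∈ Icc 0 T, ‖V t - W t‖ ≤ M * ‖y - x‖ * Real.exp (M * κ * t) := by
  refine hV.norm_sub_le_of_approx (r := fun t => U t (y - x)) hT hM hκ hW.1 (fun t ht => ?_)
    fun t ht => (U t).le_of_opNorm_le (hM t (by rw [abs_of_nonneg ht.1]; exact ht.2)) _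
  obtain ⟨hWi, hWt⟩ := hW.2 t ht
  refine ⟨hWi, ?_⟩
  rw [map_sub, hWt]
  abel

lemma IsMildSolution.eqOn (hU : IsStronglyContinuousGroup U) {K : ℝ → E →L[ℝ] E} {T κ : ℝ} {x : E}
    {V W : ℝ → E} (hT : 0 ≤ T) (hκ : ∀ s, ‖K s‖ ≤ κ) (hV : IsMildSolution U K T x V)
    (hW : IsMildSolution U K T x W) : EqOn V W (Icc 0 T) := by
  obtain ⟨M, -, hM⟩ := hU.bounded T
  intro t ht
  simpa [sub_eq_zero] using hV.norm_sub_le hT hM hκ hW t ht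

variable [CompleteSpace E]

lemma IsDuhamelValue.concat (hU : IsStronglyContinuousGroup U) {f g : ℝ → E} {τ t : ℝ}
    (hτ : 0 ≤ τ) (ht : 0 ≤ t) {x y z : E} (hf : IsDuhamelValue U f τ x y)
    (hg : IsDuhamelValue U g t y z) :
    IsDuhamelValue U (fun s => if s < τ then f s else g (s - τ)) (τ + t) x z := by
  set h : ℝ → E := fun s => if s < τ then f s else g (s - τ)
  have hτt : τ ≤ τ + t := le_add_of_nonneg_right ht
  have hleft : EqOn (fun s => U t (U (τ - s) (f s))) (fun s => U (τ + t - s) (h s)) (Ioo 0 τ) :=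
    fun s hs => by simp only [h, hs.2, if_true, ← hU.add_apply]; ring_nf
  have hright : EqOn (fun s => U (t - (s - τ)) (g (s - τ))) (fun s => U (τ + t - s) (h s))
      (Ioo τ (τ + t)) := fun s hs => by simp only [h, hs.1.not_gt, if_false]; ring_nf
  have ileft : IntervalIntegrable (fun s => U t (U (τ - s) (f s))) volume 0 τ :=
    ⟨(U t).integrable_comp hf.1.1, (U t).integrable_comp hf.1.2⟩
  have iright : IntervalIntegrable (fun s => U (t - (s - τ)) (g (s - τ))) volume τ (τ + t) := by
    simpa [add_comm] using hg.1.comp_sub_right τ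
  have ileft' := ileft.congr_uIoo (uIoo_of_le hτ ▸ hleft)
  have iright' := iright.congr_uIoo (uIoo_of_le hτt ▸ hright)
  refine ⟨ileft'.trans iright', ?_⟩
  rw [← intervalIntegral.integral_add_adjacent_intervals ileft' iright',
    ← intervalIntegral.integral_congr_Ioo_of_le hτ hleft,
    ← intervalIntegral.integral_congr_Ioo_of_le hτt hright,
    (U t).intervalIntegral_comp_comm hf.1,
    intervalIntegral.integral_comp_sub_right (fun s => U (t - s) (g s)) τ, sub_self,
    add_sub_cancel_left, hg.2, hf.2, map_add, ← hU.add_apply, add_comm t τ, add_assoc]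

lemma IsMildSolution.concat (hU : IsStronglyContinuousGroup U) {K₁ K₂ : ℝ → E →L[ℝ] E}
    {τ T : ℝ} (hτ : 0 ≤ τ) (hT : 0 ≤ T) {x : E} {W₁ W₂ : ℝ → E} (h₁ : IsMildSolution U K₁ τ x W₁)
    (h₂ : IsMildSolution U K₂ T (W₁ τ) W₂) :
    IsMildSolution U (fun s => if s < τ then K₁ s else K₂ (s - τ)) (τ + T) x
      (fun s => if s < τ then W₁ s else W₂ (s - τ)) := by
  set K : ℝ → E →L[ℝ] E := fun s => if s < τ then K₁ s else K₂ (s - τ)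
  set W : ℝ → E := fun s => if s < τ then W₁ s else W₂ (s - τ)
  have hKW : (fun s => K s (W s)) =
      fun s => if s < τ then K₁ s (W₁ s) else K₂ (s - τ) (W₂ (s - τ)) := by
    funext s
    by_cases h : s < τ <;> simp [K, W, h]
  have hleft : EqOn W W₁ (Icc 0 τ) := fun s hs => by
    rcases hs.2.lt_or_eq with h | rfl
    · simp [W, h]
    · simp [W, h₂.initial hU hT]
  have hright : EqOn W (fun s => W₂ (s - τ)) (Icc τ (τ + T)) := fun s hs => by
    simp [W, hs.1.not_gt]
  refine ⟨?_, fun t ht => ?_⟩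
  · rw [← Icc_union_Icc_eq_Icc hτ (le_add_of_nonneg_right hT)]
    refine (h₁.1.congr hleft).union_of_isClosed (ContinuousOn.congr ?_ hright)
      isClosed_Icc isClosed_Icc
    exact h₂.1.comp (by fun_prop) fun s hs => ⟨by linarith [hs.1], by linarith [hs.2]⟩
  · rw [hKW]
    rcases le_total t τ with htτ | htτ
    · rw [hleft ⟨ht.1, htτ⟩]
      refine (h₁.2 t ⟨ht.1, htτ⟩).congr_Ioo ht.1 fun s hs => ?_
      simp [hs.2.trans_le htτ]
    · rw [hright ⟨htτ, ht.2⟩]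
      have h := (h₁.2 τ ⟨hτ, le_rfl⟩).concat hU hτ (sub_nonneg.mpr htτ)
        (h₂.2 (t - τ) ⟨by linarith, by linarith [ht.2]⟩)
      rwa [add_sub_cancel] at h

lemma exists_eq_add_integral_of_mul_le {A : ℝ → E →L[ℝ] E} {τ : ℝ} {C : NNReal} (hτ : 0 ≤ τ)
    (hAc : Continuous fun p : ℝ × E => A p.1 p.2) (hA : ∀ t ∈ Icc 0 τ, ‖A t‖ ≤ C)
    (hsmall : C * 2 * τ ≤ 1) (x : E) :
    ∃ Z : ℝ → E, ContinuousOn Z (Icc 0 τ) ∧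
      ∀ t ∈ Icc 0 τ, Z t = x + ∫ s in (0 : ℝ)..t, A s (Z s) := by
  have hpl : IsPicardLindelof (fun t z => A t z) ⟨0, le_rfl, hτ⟩ x ‖x‖₊ 0 (C * (2 * ‖x‖₊)) C := by
    refine ⟨fun t ht => ((A t).lipschitz.weaken (hA t ht)).lipschitzOnWith, fun z _ => ?_,
      fun t ht z hz => ?_, ?_⟩
    · exact (hAc.comp (by fun_prop : Continuous fun t : ℝ => (t, z))).continuousOn
    · have hz' : ‖z‖ ≤ 2 * ‖x‖ := by simpa [two_mul] using norm_le_of_mem_closedBall hz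
      simpa using (A t).le_of_opNorm_le_of_le (hA t ht) hz'
    · simp only [sub_zero, max_eq_left hτ, NNReal.coe_zero, NNReal.coe_mul, NNReal.coe_ofNat,
        coe_nnnorm]
      nlinarith [norm_nonneg x]
  obtain ⟨Z, hZ0, hZ⟩ := hpl.exists_eq_forall_mem_Icc_hasDerivWithinAt₀
  refine ⟨Z, HasDerivWithinAt.continuousOn hZ, fun t ht => ?_⟩
  have hsub : uIcc 0 t ⊆ Icc 0 τ := uIcc_of_le ht.1 ▸ Icc_subset_Icc_right ht.2
  rw [← hZ0]
  exact (ODE.picard_eq_of_hasDerivAt (f := fun t z => A t z) hAc.continuousOn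
    (fun s hs => (hZ s (hsub hs)).mono hsub) (mapsTo_univ _ _)).symm

-- In the interaction picture `Z(t) = U(-t) W(t)` the equation `W' = (𝒜 + K) W` becomes the
-- ordinary differential equation `Z' = U(-t) K U(t) Z`.
lemma exists_isMildSolution_const_of_mul_le (hU : IsStronglyContinuousGroup U) (K : E →L[ℝ] E)
    {M τ : ℝ} (hτ : 0 ≤ τ) (hM : ∀ t, |t| ≤ τ → ‖U t‖ ≤ M) (hsmall : M * ‖K‖ * M * 2 * τ ≤ 1)
    (x : E) : ∃ W, IsMildSolution U (fun _ => K) τ x W := by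
  have hM0 : 0 ≤ M := (norm_nonneg _).trans (hM 0 (by rwa [abs_zero]))
  lift M to NNReal using hM0
  set A : ℝ → E →L[ℝ] E := fun t => U (-t) ∘L K ∘L U t
  have hA : ∀ t ∈ Icc (0 : ℝ) τ, ‖A t‖ ≤ (M * ‖K‖₊ * M : NNReal) := fun t ht => by
    have ht' : |t| ≤ τ := by rw [abs_of_nonneg ht.1]; exact ht.2
    calc ‖A t‖ ≤ ‖U (-t)‖ * (‖K‖ * ‖U t‖) :=
          (ContinuousLinearMap.opNorm_comp_le _ _).trans
            (by gcongr; exact ContinuousLinearMap.opNorm_comp_le _ _)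
      _ ≤ M * (‖K‖ * M) := by
          gcongr
          exacts [hM _ (by rwa [abs_neg]), hM _ ht']
      _ = (M * ‖K‖₊ * M : NNReal) := by
          push_cast
          rw [mul_assoc]
  have hUc := hU.continuous_uncurry
  have hAc : Continuous fun p : ℝ × E => A p.1 p.2 :=
    hUc.comp (by fun_prop : Continuous fun p : ℝ × E => (-p.1, K (U p.1 p.2)))
  obtain ⟨Z, hZc, hZ⟩ := exists_eq_add_integral_of_mul_le hτ hAc hA (by simpa using hsmall) x
  have hWc : ContinuousOn (fun t => U t (Z t)) (Icc 0 τ) :=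
    hUc.comp_continuousOn (continuousOn_id.prodMk hZc)
  refine ⟨fun t => U t (Z t), hWc, fun t ht => ?_⟩
  have hsub : uIcc 0 t ⊆ Icc 0 τ := uIcc_of_le ht.1 ▸ Icc_subset_Icc_right ht.2
  have hUA : ∀ s, U t (A s (Z s)) = U (t - s) (K (U s (Z s))) := fun s => by
    rw [sub_eq_add_neg, hU.add_apply]
    rfl
  have hAi : IntervalIntegrable (fun s => A s (Z s)) volume 0 t :=
    (hAc.comp_continuousOn (continuousOn_id.prodMk (hZc.mono hsub))).intervalIntegrable
  refine ⟨(hUc.comp_continuousOn ((by fun_prop : Continuous fun s : ℝ => t - s).continuousOn.prodMk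
    (K.continuous.comp_continuousOn (hWc.mono hsub)))).intervalIntegrable, ?_⟩
  simp only
  rw [hZ t ht, map_add, ← (U t).intervalIntegral_comp_comm hAi]
  simp only [hUA]

lemma exists_isMildSolution_const (hU : IsStronglyContinuousGroup U) (K : E →L[ℝ] E) {T : ℝ}
    (hT : 0 ≤ T) (x : E) : ∃ W, IsMildSolution U (fun _ => K) T x W := by
  obtain ⟨M, -, hM⟩ := hU.bounded T
  have hM0 : 0 ≤ M := (norm_nonneg _).trans (hM 0 (by rwa [abs_zero]))
  obtain ⟨n, hn⟩ := exists_nat_gt (M * ‖K‖ * M * 2 * T)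
  have hn0 : (0 : ℝ) < n := (by positivity : 0 ≤ M * ‖K‖ * M * 2 * T).trans_lt hn
  have hτ : 0 ≤ T / n := by positivity
  have hτT : T / n ≤ T := div_le_self hT (by exact_mod_cast hn0)
  have hsmall : M * ‖K‖ * M * 2 * (T / n) ≤ 1 := by
    rw [← mul_div_assoc, div_le_one hn0]
    exact hn.le
  have hsteps : ∀ m : ℕ, ∀ x, ∃ W, IsMildSolution U (fun _ => K) (m * (T / n)) x W := by
    intro m
    induction m with
    | zero => exact fun x => ⟨_, by simpa using isMildSolution_zero hU (fun _ => K) x⟩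
    | succ m ih =>
      intro x
      obtain ⟨W₁, hW₁⟩ := exists_isMildSolution_const_of_mul_le hU K hτ
        (fun t ht => hM t (ht.trans hτT)) hsmall x
      obtain ⟨W₂, hW₂⟩ := ih (W₁ (T / n))
      have h := hW₁.concat hU hτ (by positivity) hW₂
      simp only [ite_self] at h
      exact ⟨_, by rwa [Nat.cast_succ, add_one_mul, add_comm]⟩
  simpa [mul_div_cancel₀ _ hn0.ne'] using hsteps n x

end Group

/-! ### Approximate steering by piecewise constant perturbations -/

section Steering

open Filter Topology

variable {E : Type*} [NormedAddCommGroup E] [NormedSpace ℝ E] {U : ℝ → E →L[ℝ] E}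

/-- The mild solution on `[0, T]` for the constant perturbation `K`, chosen by
`exists_isMildSolution_const`. Outside `[0, T]` its values are arbitrary. -/
def mildSolution (U : ℝ → E →L[ℝ] E) (K : E →L[ℝ] E) (T : ℝ) (x : E) : ℝ → E :=
  Classical.epsilon fun W => IsMildSolution U (fun _ => K) T x W

/-- The flow at time `T` of the constant perturbation `K`. -/
def mildFlow (U : ℝ → E →L[ℝ] E) (K : E →L[ℝ] E) (T : ℝ) (x : E) : E := mildSolution U K T x T

variable {X : Type*}

/-- The final state after consecutively applying the controls `c` for the times `τ` of a list of
pairs `(τ, c)`, where the control `c` acts through the perturbation `K c`. -/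
def listFlow (U : ℝ → E →L[ℝ] E) (K : X → E →L[ℝ] E) : List (ℝ × X) → E → E
  | [], x => x
  | e :: l, x => listFlow U K l (mildFlow U (K e.2) e.1 x)

/-- The control of a list of pairs (duration, value) as a function of time, extended by `c₀` after
the last switching time. -/
def listControl (c₀ : X) : List (ℝ × X) → ℝ → X
  | [], _ => c₀
  | e :: l, s => if s < e.1 then e.2 else listControl c₀ l (s - e.1)

/-- The total duration of a list of pairs (duration, value). -/
def listTime (l : List (ℝ × X)) : ℝ := (l.map Prod.fst).sum

/-- The states reached exactly from `x` by piecewise constant controls within time `η`. -/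
def reachableSet (U : ℝ → E →L[ℝ] E) (K : X → E →L[ℝ] E) (η : ℝ) (x : E) : Set E :=
  {y | ∃ l : List (ℝ × X), (∀ e ∈ l, 0 < e.1) ∧ listTime l < η ∧ listFlow U K l x = y}

/-- `y` can be approximately reached from `x` by piecewise constant controls within time `η`. -/
def SteersTo (U : ℝ → E →L[ℝ] E) (K : X → E →L[ℝ] E) (η : ℝ) (x y : E) : Prop :=
  y ∈ closure (reachableSet U K η x)

lemma listTime_cons (e : ℝ × X) (l : List (ℝ × X)) : listTime (e :: l) = e.1 + listTime l := by
  simp [listTime]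

lemma listTime_append (l l' : List (ℝ × X)) : listTime (l ++ l') = listTime l + listTime l' := by
  simp [listTime]

lemma listTime_nonneg {l : List (ℝ × X)} (hl : ∀ e ∈ l, 0 < e.1) : 0 ≤ listTime l :=
  List.sum_nonneg (List.forall_mem_map.mpr fun e he => (hl e he).le)

lemma listFlow_append (K : X → E →L[ℝ] E) (l l' : List (ℝ × X)) (x : E) :
    listFlow U K (l ++ l') x = listFlow U K l' (listFlow U K l x) := by
  induction l generalizing x with
  | nil => rfl
  | cons e _ ih => exact ih _

lemma exists_norm_listControl_le (K : X → E →L[ℝ] E) (c₀ : X) (l : List (ℝ × X)) :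
    ∃ κ, ∀ s, ‖K (listControl c₀ l s)‖ ≤ κ := by
  induction l with
  | nil => exact ⟨‖K c₀‖, fun s => le_rfl⟩
  | cons e l ih =>
    obtain ⟨κ, hκ⟩ := ih
    refine ⟨max ‖K e.2‖ κ, fun s => ?_⟩
    simp only [listControl]
    split_ifs
    exacts [le_max_left _ _, (hκ _).trans (le_max_right _ _)]

lemma isPiecewiseConstant_zero {p : ℝ → X} : IsPiecewiseConstant 0 p :=
  ⟨0, fun _ => 0, fun i j h => absurd h (by omega), rfl, rfl, fun i => i.elim0⟩

lemma IsPiecewiseConstant.cons {τ T : ℝ} {p : ℝ → X} (hτ : 0 < τ) (c : X)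
    (hp : IsPiecewiseConstant T p) :
    IsPiecewiseConstant (τ + T) fun s => if s < τ then c else p (s - τ) := by
  obtain ⟨N, t, hmono, h0, hN, hc⟩ := hp
  refine ⟨N + 1, Fin.cons 0 fun i => τ + t i, ?_, rfl, ?_, ?_⟩
  · refine Fin.strictMono_iff_lt_succ.mpr (Fin.cases ?_ fun j => ?_)
    · simpa [h0] using hτ
    · simpa [← Fin.succ_castSucc] using hmono (Fin.castSucc_lt_succ (i := j))
  · rw [← Fin.succ_last, Fin.cons_succ, hN]
  · refine Fin.cases ⟨c, fun s hs => ?_⟩ fun j => ?_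
    · have hsτ : s < τ := by simpa [h0] using hs.2
      simp [hsτ]
    · obtain ⟨a, ha⟩ := hc j
      refine ⟨a, fun s hs => ?_⟩
      rw [← Fin.succ_castSucc, Fin.cons_succ, Fin.cons_succ] at hs
      have ht : 0 ≤ t j.castSucc := h0 ▸ hmono.monotone (Fin.zero_le _)
      have hsτ : ¬ s < τ := by linarith [hs.1]
      simp only [hsτ, if_false]
      exact ha _ ⟨by linarith [hs.1], by linarith [hs.2]⟩

lemma isPiecewiseConstant_listControl (c₀ : X) (l : List (ℝ × X)) (hl : ∀ e ∈ l, 0 < e.1) :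
    IsPiecewiseConstant (listTime l) (listControl c₀ l) := by
  induction l with
  | nil => exact isPiecewiseConstant_zero
  | cons e l ih =>
    obtain ⟨he, hl⟩ := List.forall_mem_cons.mp hl
    rw [listTime_cons]
    exact (ih hl).cons he e.2

lemma SteersTo.of_tendsto {ι : Type*} {F : Filter ι} [F.NeBot] {K : X → E →L[ℝ] E} {η : ℝ}
    {x y : E} {z : ι → E} (hz : Tendsto z F (𝓝 y)) (h : ∀ᶠ i in F, SteersTo U K η x (z i)) :
    SteersTo U K η x y :=
  isClosed_closure.mem_of_tendsto hz h

lemma SteersTo.of_forall_near {K : X → E →L[ℝ] E} {η : ℝ} {x y : E}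
    (h : ∀ ε > 0, ∃ z, SteersTo U K η x z ∧ ‖z - y‖ < ε) : SteersTo U K η x y :=
  isClosed_closure.closure_subset <| Metric.mem_closure_iff.mpr fun ε hε => by
    obtain ⟨z, hz, hzy⟩ := h ε hε
    exact ⟨z, hz, by rwa [dist_comm, dist_eq_norm]⟩

lemma IsStronglyContinuousGroup.eventually_norm_sub_le (hU : IsStronglyContinuousGroup U) (x : E)
    {ε : ℝ} (hε : 0 < ε) : ∀ᶠ δ in 𝓝[>] (0 : ℝ), ∀ t ∈ Icc 0 δ, ‖U t x - x‖ ≤ ε := by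
  obtain ⟨ρ, hρ, hclose⟩ := Metric.continuousAt_iff.mp
    ((hU.continuous_apply x).continuousAt (x := (0 : ℝ))) ε hε
  filter_upwards [Ioo_mem_nhdsGT hρ] with δ hδ t ht
  have htρ : dist t 0 < ρ := by
    rw [Real.dist_0_eq_abs, abs_of_nonneg ht.1]
    exact ht.2.trans_lt hδ.2
  simpa [hU.zero_apply, dist_eq_norm] using (hclose htρ).le

lemma steersTo_mildFlow (K : X → E →L[ℝ] E) {η δ : ℝ} (hδ : 0 < δ) (hη : δ < η) (c : X) (x : E) :
    SteersTo U K η x (mildFlow U (K c) δ x) :=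
  subset_closure ⟨[(δ, c)], by simpa using hδ, by simpa [listTime] using hη, rfl⟩

variable [CompleteSpace E]

lemma isMildSolution_mildSolution (hU : IsStronglyContinuousGroup U) (K : E →L[ℝ] E) {T : ℝ}
    (hT : 0 ≤ T) (x : E) : IsMildSolution U (fun _ => K) T x (mildSolution U K T x) :=
  Classical.epsilon_spec (exists_isMildSolution_const hU K hT x)

lemma mildFlow_zero (hU : IsStronglyContinuousGroup U) {T : ℝ} (hT : 0 ≤ T) (x : E) :
    mildFlow U 0 T x = U T x :=
  ((isMildSolution_mildSolution hU 0 hT x).2 T ⟨hT, le_rfl⟩).2.trans (by simp)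

lemma continuous_mildFlow (hU : IsStronglyContinuousGroup U) (K : E →L[ℝ] E) {T : ℝ}
    (hT : 0 ≤ T) : Continuous (mildFlow U K T) := by
  obtain ⟨M, -, hM⟩ := hU.bounded T
  refine (LipschitzWith.of_dist_le' (K := M * Real.exp (M * ‖K‖ * T)) fun x y => ?_).continuous
  rw [dist_eq_norm, dist_comm x, dist_eq_norm, mul_right_comm]
  exact (isMildSolution_mildSolution hU K hT x).norm_sub_le hT hM (fun _ => le_rfl)
    (isMildSolution_mildSolution hU K hT y) T ⟨hT, le_rfl⟩

lemma isDuhamelValue_const (hU : IsStronglyContinuousGroup U) (t : ℝ) (x y : E) :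
    IsDuhamelValue U (fun _ => y) t x
      (x + t • y - (-(U t x - x) - ∫ s in (0 : ℝ)..t, (U (t - s) y - y))) := by
  have hUi : IntervalIntegrable (fun s => U (t - s) y) volume 0 t :=
    ((hU.continuous_apply y).comp (continuous_const.sub continuous_id)).intervalIntegrable _ _
  refine ⟨hUi, ?_⟩
  rw [intervalIntegral.integral_sub hUi intervalIntegrable_const,
    intervalIntegral.integral_const, sub_zero]
  abel

-- On the time scale `δ` the group is almost the identity, so that the solution almost follows
-- `Y(t) = x + (t / δ) K x`, along which `K Y = K x` because `K² = 0`.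
lemma norm_mildFlow_impulse_sub_le (hU : IsStronglyContinuousGroup U) {K : E →L[ℝ] E}
    (hK : ∀ x, K (K x) = 0) {x : E} {δ M η : ℝ} (hδ : 0 < δ) (hM : ∀ t, |t| ≤ δ → ‖U t‖ ≤ M)
    (hx : ∀ t ∈ Icc 0 δ, ‖U t x - x‖ ≤ η) (hKx : ∀ t ∈ Icc 0 δ, ‖U t (K x) - K x‖ ≤ η) :
    ‖mildFlow U (δ⁻¹ • K) δ x - (x + K x)‖ ≤ 2 * η * Real.exp (M * ‖K‖) := by
  have hδ' : 0 ≤ δ⁻¹ := inv_nonneg.mpr hδ.le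
  set y : E := δ⁻¹ • K x with hy
  set Y : ℝ → E := fun t => x + t • y with hY
  set r : ℝ → E := fun t => -(U t x - x) - ∫ s in (0 : ℝ)..t, (U (t - s) y - y)
  have hKY : ∀ t, (δ⁻¹ • K) (Y t) = y := fun t => by simp [hY, hy, hK]
  have hYr : ∀ t ∈ Icc 0 δ, IsDuhamelValue U (fun s => (δ⁻¹ • K) (Y s)) t x (Y t - r t) :=
    fun t _ => by
      simp only [hKY]
      exact isDuhamelValue_const hU t x y
  have hy_near : ∀ t ∈ Icc 0 δ, ‖U t y - y‖ ≤ δ⁻¹ * η := fun t ht => by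
    rw [hy, map_smul, ← smul_sub, norm_smul, Real.norm_of_nonneg hδ']
    gcongr
    exact hKx t ht
  have hr : ∀ t ∈ Icc 0 δ, ‖r t‖ ≤ 2 * η := fun t ht => by
    have hint : ‖∫ s in (0 : ℝ)..t, (U (t - s) y - y)‖ ≤ δ⁻¹ * η * |t - 0| :=
      intervalIntegral.norm_integral_le_of_norm_le_const fun s hs => by
        rw [uIoc_of_le ht.1] at hs
        exact hy_near _ ⟨by linarith [hs.2], by linarith [hs.1, ht.2]⟩
    have hη : 0 ≤ η := (norm_nonneg _).trans (hx t ht)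
    calc ‖r t‖ ≤ ‖U t x - x‖ + ‖∫ s in (0 : ℝ)..t, (U (t - s) y - y)‖ := by
          rw [← norm_neg (U t x - x)]
          exact norm_sub_le _ _
      _ ≤ η + δ⁻¹ * η * δ := by
          rw [sub_zero, abs_of_nonneg ht.1] at hint
          exact add_le_add (hx t ht) (hint.trans (by gcongr; exact ht.2))
      _ = 2 * η := by field_simp; ring
  have h := (isMildSolution_mildSolution hU (δ⁻¹ • K) hδ.le x).norm_sub_le_of_approx hδ.le hM
    (fun _ => le_rfl) (by fun_prop) hYr hr δ ⟨hδ.le, le_rfl⟩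
  rw [norm_smul, Real.norm_of_nonneg hδ', (by field_simp : M * (δ⁻¹ * ‖K‖) * δ = M * ‖K‖)] at h
  simpa only [mildFlow, hY, hy, smul_inv_smul₀ hδ.ne'] using h

lemma tendsto_mildFlow_impulse (hU : IsStronglyContinuousGroup U) {K : E →L[ℝ] E}
    (hK : ∀ x, K (K x) = 0) (x : E) :
    Tendsto (fun δ : ℝ => mildFlow U (δ⁻¹ • K) δ x) (𝓝[>] 0) (𝓝 (x + K x)) := by
  obtain ⟨M, -, hM⟩ := hU.bounded 1
  rw [Metric.tendsto_nhds]
  intro ε hε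
  set B := Real.exp (M * ‖K‖)
  have hB : 0 < B := Real.exp_pos _
  have hη : 0 < ε / (4 * B) := by positivity
  filter_upwards [Ioo_mem_nhdsGT one_pos, hU.eventually_norm_sub_le x hη,
    hU.eventually_norm_sub_le (K x) hη] with δ hδ hx hKx
  rw [dist_eq_norm]
  calc _ ≤ 2 * (ε / (4 * B)) * B :=
        norm_mildFlow_impulse_sub_le hU hK hδ.1 (fun t ht => hM t (ht.trans hδ.2.le)) hx hKx
    _ = ε / 2 := by field_simp; norm_num
    _ < ε := half_lt_self hε

lemma continuous_listFlow (hU : IsStronglyContinuousGroup U) (K : X → E →L[ℝ] E)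
    {l : List (ℝ × X)} (hl : ∀ e ∈ l, 0 < e.1) : Continuous (listFlow U K l) := by
  induction l with
  | nil => exact continuous_id
  | cons e l ih =>
    obtain ⟨he, hl⟩ := List.forall_mem_cons.mp hl
    exact (ih hl).comp (continuous_mildFlow hU (K e.2) he.le)

lemma exists_isMildSolution_listControl (hU : IsStronglyContinuousGroup U) (K : X → E →L[ℝ] E)
    (c₀ : X) (l : List (ℝ × X)) (hl : ∀ e ∈ l, 0 < e.1) (x : E) :
    ∃ W, IsMildSolution U (fun s => K (listControl c₀ l s)) (listTime l) x W ∧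
      W (listTime l) = listFlow U K l x := by
  induction l generalizing x with
  | nil => exact ⟨_, isMildSolution_zero hU _ x, rfl⟩
  | cons e l ih =>
    obtain ⟨he, hl⟩ := List.forall_mem_cons.mp hl
    have h₁ := isMildSolution_mildSolution hU (K e.2) he.le x
    obtain ⟨W, hW, hWend⟩ := ih hl (mildFlow U (K e.2) e.1 x)
    have h := h₁.concat hU he.le (listTime_nonneg hl) hW
    rw [listTime_cons]
    refine ⟨_, by simpa only [listControl, apply_ite K] using h, ?_⟩
    simp only [(le_add_of_nonneg_right (listTime_nonneg hl)).not_gt, if_false,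
      add_sub_cancel_left, hWend]
    rfl

lemma SteersTo.trans (hU : IsStronglyContinuousGroup U) {K : X → E →L[ℝ] E} {η η' : ℝ}
    {x y z : E} (h : SteersTo U K η x y) (h' : SteersTo U K η' y z) :
    SteersTo U K (η + η') x z := by
  refine closure_minimal ?_ isClosed_closure h'
  rintro _ ⟨l', hl', ht', rfl⟩
  refine map_mem_closure (continuous_listFlow hU K hl') h ?_
  rintro _ ⟨l, hl, ht, rfl⟩
  exact ⟨l ++ l', List.forall_mem_append.mpr ⟨hl, hl'⟩, by rw [listTime_append]; linarith,
    listFlow_append K l l' x⟩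

lemma steersTo_free (hU : IsStronglyContinuousGroup U) {K : X → E →L[ℝ] E} {c : X} (hc : K c = 0)
    {η δ : ℝ} (hδ : 0 < δ) (hη : δ < η) (x : E) : SteersTo U K η x (U δ x) := by
  rw [← mildFlow_zero hU hδ.le, ← hc]
  exact steersTo_mildFlow K hδ hη c x

lemma steersTo_impulse (hU : IsStronglyContinuousGroup U) {K : X → E →L[ℝ] E} {B : E →L[ℝ] E}
    (hB : ∀ x, B (B x) = 0) (hKB : ∀ δ : ℝ, 0 < δ → ∃ c, K c = δ⁻¹ • B) {η : ℝ} (hη : 0 < η)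
    (x : E) : SteersTo U K η x (x + B x) := by
  refine SteersTo.of_tendsto (tendsto_mildFlow_impulse hU hB x) ?_
  filter_upwards [Ioo_mem_nhdsGT hη] with δ hδ
  obtain ⟨c, hc⟩ := hKB δ hδ.1
  rw [← hc]
  exact steersTo_mildFlow K hδ.1 hδ.2 c x

lemma exists_listFlow_near (hU : IsStronglyContinuousGroup U) {K : X → E →L[ℝ] E} {c : X}
    (hc : K c = 0) {x : E} (hx : ∀ η > 0, ∀ y, SteersTo U K η x y) (z : E) {ε T : ℝ} (hε : 0 < ε)
    (hT : 0 < T) : ∃ l : List (ℝ × X), (∀ e ∈ l, 0 < e.1) ∧ listTime l = T ∧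
      ‖listFlow U K l x - z‖ < ε := by
  have hcont : Continuous fun p : ℝ × E => U (T - p.1) p.2 :=
    hU.continuous_uncurry.comp (by fun_prop : Continuous fun p : ℝ × E => (T - p.1, p.2))
  -- Aim at `U (-T) z` within a short time and let the free evolution do the rest.
  obtain ⟨ρ, hρ, hclose⟩ := Metric.continuousAt_iff.mp
    (hcont.continuousAt (x := (0, U (-T) z))) ε hε
  obtain ⟨_, ⟨l, hl, hlt, rfl⟩, hdist⟩ :=
    Metric.mem_closure_iff.mp (hx (min ρ T) (lt_min hρ hT) (U (-T) z)) ρ hρ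
  have hrest : 0 < T - listTime l := sub_pos.mpr (hlt.trans_le (min_le_right _ _))
  refine ⟨l ++ [(T - listTime l, c)], List.forall_mem_append.mpr ⟨hl, by simpa using hrest⟩,
    by simp [listTime], ?_⟩
  have hend : listFlow U K (l ++ [(T - listTime l, c)]) x =
      U (T - listTime l) (listFlow U K l x) := by
    rw [listFlow_append, ← mildFlow_zero hU hrest.le, ← hc]
    rfl
  have hnear : dist (listTime l, listFlow U K l x) (0, U (-T) z) < ρ := by
    rw [Prod.dist_eq, max_lt_iff, Real.dist_0_eq_abs, abs_of_nonneg (listTime_nonneg hl), dist_comm]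
    exact ⟨hlt.trans_le (min_le_left _ _), hdist⟩
  simpa [hend, hU.neg_apply_self, dist_eq_norm] using hclose hnear

end Steering

/-! ### Fourier series on the torus -/

/-- The character `x ↦ e^{ikx}` of the torus, that is, the eigenfunction `φ_k` without its
normalisation, so that products of characters are characters. -/
def character (k : Fin d → ℤ) : C(Torus d, ℂ) where
  toFun x := ∏ i, fourier (k i) (x i)
  continuous_toFun := by fun_prop

lemma character_apply (k : Fin d → ℤ) (x : Torus d) :
    character k x = ∏ i, (fourier (k i) (x i) : ℂ) := rfl

lemma character_neg (k : Fin d → ℤ) (x : Torus d) : character (-k) x = conj (character k x) := by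
  simp only [character_apply, Pi.neg_apply, fourier_neg, map_prod]

lemma character_add (k m : Fin d → ℤ) (x : Torus d) :
    character (k + m) x = character k x * character m x := by
  simp only [character_apply, Pi.add_apply, fourier_add, Finset.prod_mul_distrib]

lemma character_zero (x : Torus d) : character (0 : Fin d → ℤ) x = 1 := by
  simp [character_apply]

lemma character_single (i : Fin d) (x : Torus d) :
    character (Pi.single i 1) x = fourier 1 (x i) := by
  rw [character_apply, Finset.prod_eq_single i]
  · simp
  · intro j _ hj
    simp [Pi.single_eq_of_ne hj]
  · simp

lemma integral_character (k : Fin d → ℤ) :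
    ∫ x : Torus d, character k x = if k = 0 then ((2 * Real.pi) ^ d : ℂ) else 0 := by
  split_ifs with h
  · subst h
    have hv : (volume : Measure (Torus d)).real univ = (2 * Real.pi) ^ d := by
      rw [Measure.real, volume_pi, Measure.pi_univ]
      simp only [AddCircle.measure_univ, Finset.prod_const, Finset.card_univ, Fintype.card_fin,
        ENNReal.toReal_pow, ENNReal.toReal_ofReal Real.two_pi_pos.le]
    simp [character_zero, hv]
  · exact integral_prod_fourier k h

lemma fourier_homeomorphAddCircle {p q : ℝ} (hp : p ≠ 0) (hq : q ≠ 0) (n : ℤ) (x : AddCircle p) :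
    (fourier n (AddCircle.homeomorphAddCircle p q hp hq x) : ℂ) = fourier n x := by
  obtain ⟨y, rfl⟩ := QuotientAddGroup.mk_surjective x
  rw [AddCircle.homeomorphAddCircle_apply_mk, fourier_coe_apply, fourier_coe_apply]
  have hq' : (q : ℂ) ≠ 0 := Complex.ofReal_ne_zero.mpr hq
  congr 1
  push_cast
  field_simp

/-- The rescaling of the torus onto the standard torus `(ℝ / ℤ)^d`, used to transport the density
of the trigonometric polynomials. -/
def torusHomeomorph (d : ℕ) : Torus d ≃ₜ UnitAddTorus (Fin d) :=
  Homeomorph.piCongrRight fun _ =>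
    AddCircle.homeomorphAddCircle (2 * Real.pi) 1 Real.two_pi_pos.ne' one_ne_zero

lemma mFourier_torusHomeomorph (k : Fin d → ℤ) (x : Torus d) :
    UnitAddTorus.mFourier k (torusHomeomorph d x) = character k x :=
  Fintype.prod_congr _ _ fun i =>
    fourier_homeomorphAddCircle Real.two_pi_pos.ne' one_ne_zero (k i) (x i)

lemma span_character_closure_eq_top :
    (Submodule.span ℂ (range (character (d := d)))).topologicalClosure = ⊤ := by
  let Φ : C(UnitAddTorus (Fin d), ℂ) →L[ℂ] C(Torus d, ℂ) :=
    ContinuousMap.compCLM ℂ ℂ (torusHomeomorph d : C(Torus d, UnitAddTorus (Fin d)))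
  have hΦ : Function.Surjective Φ := fun f =>
    ⟨f.comp ((torusHomeomorph d).symm : C(UnitAddTorus (Fin d), Torus d)), by
      ext x
      change f ((torusHomeomorph d).symm (torusHomeomorph d x)) = f x
      rw [Homeomorph.symm_apply_apply]⟩
  have hc : ⇑Φ ∘ UnitAddTorus.mFourier = character :=
    funext fun k => ContinuousMap.ext fun x => mFourier_torusHomeomorph k x
  have h := hΦ.denseRange.topologicalClosure_map_submodule
    (UnitAddTorus.span_mFourier_closure_eq_top (d := Fin d))
  rwa [Submodule.map_span, ContinuousLinearMap.coe_coe, ← range_comp, hc] at h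

/-- The normalisation constant `(2π)^{-d/2}` of the eigenfunctions. -/
def modeScale (d : ℕ) : ℝ := (2 * Real.pi) ^ (-(d : ℝ) / 2)

lemma modeScale_pos (d : ℕ) : 0 < modeScale d := Real.rpow_pos_of_pos Real.two_pi_pos _

lemma modeScale_sq (d : ℕ) : modeScale d ^ 2 * (2 * Real.pi) ^ d = 1 := by
  rw [modeScale, ← Real.rpow_natCast, ← Real.rpow_natCast, ← Real.rpow_mul Real.two_pi_pos.le,
    ← Real.rpow_add Real.two_pi_pos]
  norm_num

lemma eigenfunction_eq_smul (k : Fin d → ℤ) : eigenfunction k = (modeScale d : ℂ) • character k :=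
  rfl

lemma eigenfunction_apply (k : Fin d → ℤ) (x : Torus d) :
    eigenfunction k x = modeScale d * character k x := rfl

lemma eigenfunction_neg (k : Fin d → ℤ) (x : Torus d) :
    eigenfunction (-k) x = conj (eigenfunction k x) := by
  simp [eigenfunction_apply, character_neg]

lemma integral_eigenfunction_mul_conj (k j : Fin d → ℤ) :
    ∫ x : Torus d, eigenfunction k x * conj (eigenfunction j x) = if k = j then 1 else 0 := by
  have e : ∀ x : Torus d, eigenfunction k x * conj (eigenfunction j x) =
      (modeScale d : ℂ) ^ 2 * character (k - j) x := by
    intro x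
    rw [sub_eq_add_neg, character_add, character_neg, eigenfunction_apply, eigenfunction_apply,
      map_mul, Complex.conj_ofReal]
    ring
  simp_rw [e]
  rw [integral_const_mul, integral_character]
  simp only [sub_eq_zero]
  split_ifs
  · exact_mod_cast modeScale_sq d
  · simp

open scoped Pointwise in
lemma span_eigenfunction_closure_eq_top :
    (Submodule.span ℂ (range (eigenfunction (d := d)))).topologicalClosure = ⊤ := by
  have h0 : IsUnit (modeScale d : ℂ) :=
    (Complex.ofReal_ne_zero.mpr (modeScale_pos d).ne').isUnit
  have hr : range (eigenfunction (d := d)) = (modeScale d : ℂ) • range character := by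
    rw [← range_smul]
    exact congrArg range (funext eigenfunction_eq_smul)
  rw [hr, Submodule.span_smul_eq_of_isUnit _ _ h0]
  exact span_character_closure_eq_top

/-- The eigenfunctions as elements of the complex `L²` space, where they form a Hilbert basis. -/
def eigenfunctionLp (k : Fin d → ℤ) : Lp ℂ 2 (volume : Measure (Torus d)) :=
  ContinuousMap.toLp (E := ℂ) 2 volume ℂ (eigenfunction k)

lemma orthonormal_eigenfunctionLp : Orthonormal ℂ (eigenfunctionLp (d := d)) := by
  rw [orthonormal_iff_ite]
  intro m n
  simp only [eigenfunctionLp, ContinuousMap.inner_toLp]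
  rw [integral_eigenfunction_mul_conj]
  simp [eq_comm]

lemma span_eigenfunctionLp_closure_eq_top :
    (Submodule.span ℂ (range (eigenfunctionLp (d := d)))).topologicalClosure = ⊤ := by
  have := (ContinuousMap.toLp_denseRange ℂ (volume : Measure (Torus d)) ℂ
    (p := 2) (by simp)).topologicalClosure_map_submodule span_eigenfunction_closure_eq_top
  simpa only [Submodule.map_span, ContinuousLinearMap.coe_coe, ← range_comp, Function.comp_def]
    using! this

/-- The Hilbert basis of the complex `L²` space given by the eigenfunctions. -/
def eigenBasis (d : ℕ) : HilbertBasis (Fin d → ℤ) ℂ (Lp ℂ 2 (volume : Measure (Torus d))) :=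
  HilbertBasis.mk orthonormal_eigenfunctionLp span_eigenfunctionLp_closure_eq_top.ge

lemma eigenBasis_apply (k : Fin d → ℤ) : eigenBasis d k = eigenfunctionLp k := by
  rw [eigenBasis, HilbertBasis.coe_mk]

/-- The embedding of real into complex `L²` functions. -/
def complexify (d : ℕ) : L2 d →L[ℝ] Lp ℂ 2 (volume : Measure (Torus d)) :=
  Complex.ofRealCLM.compLpL 2 volume

/-- The real part of a complex `L²` function, as a left inverse of `complexify`. -/
def realPart (d : ℕ) : Lp ℂ 2 (volume : Measure (Torus d)) →L[ℝ] L2 d :=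
  Complex.reCLM.compLpL 2 volume

lemma coeFn_complexify (f : L2 d) : ∀ᵐ x, complexify d f x = (f x : ℂ) :=
  Complex.ofRealCLM.coeFn_compLpL f

lemma coeFn_realPart (f : Lp ℂ 2 (volume : Measure (Torus d))) :
    ∀ᵐ x, realPart d f x = (f x).re := Complex.reCLM.coeFn_compLpL f

lemma norm_complexify (f : L2 d) : ‖complexify d f‖ = ‖f‖ := by
  rw [Lp.norm_def, Lp.norm_def]
  congr 1
  refine eLpNorm_congr_norm_ae ?_
  filter_upwards [coeFn_complexify f] with x hx
  simp [hx]

lemma eigenBasis_repr_complexify (f : L2 d) (k : Fin d → ℤ) :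
    (eigenBasis d).repr (complexify d f) k = coeff f k := by
  rw [HilbertBasis.repr_apply_apply, eigenBasis_apply, L2.inner_def]
  refine integral_congr_ae ?_
  filter_upwards [coeFn_complexify f,
    ContinuousMap.coeFn_toLp (𝕜 := ℂ) (p := 2) volume (eigenfunction k)] with x hx hy
  simp only [eigenfunctionLp, hx, hy, RCLike.inner_apply]

/-- The Fourier coefficient `f ↦ ⟨f, φ_k⟩` as a continuous linear map. -/
def coeffCLM (k : Fin d → ℤ) : L2 d →L[ℝ] ℂ where
  toFun f := coeff f k
  map_add' f g := coeff_add f g k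
  map_smul' c f := by rw [coeff_smul, RingHom.id_apply, Complex.real_smul]
  cont := continuous_coeff k

lemma coeff_zero (k : Fin d → ℤ) : coeff (0 : L2 d) k = 0 := map_zero (coeffCLM k)

lemma coeff_sub (f g : L2 d) (k : Fin d → ℤ) : coeff (f - g) k = coeff f k - coeff g k :=
  map_sub (coeffCLM k) f g

lemma coeff_neg_index (f : L2 d) (k : Fin d → ℤ) : coeff f (-k) = conj (coeff f k) := by
  rw [coeff, coeff, ← integral_conj]
  simp [eigenfunction_neg]

lemma hasSum_norm_coeff_sq (f : L2 d) : HasSum (fun k => ‖coeff f k‖ ^ 2) (‖f‖ ^ 2) := by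
  have h := lp.hasSum_norm (p := 2) (by norm_num) ((eigenBasis d).repr (complexify d f))
  simpa [eigenBasis_repr_complexify, norm_complexify] using h

lemma coeff_ext {f g : L2 d} (h : ∀ k, coeff f k = coeff g k) : f = g := by
  have h0 : HasSum (fun _ : Fin d → ℤ => (0 : ℝ)) (‖f - g‖ ^ 2) := by
    simpa [coeff_sub, h] using hasSum_norm_coeff_sq (f - g)
  exact sub_eq_zero.mp (norm_eq_zero.mp (sq_eq_zero_iff.mp (h0.unique hasSum_zero)))

lemma coeFn_modeL2 (a : ℂ) (k : Fin d → ℤ) :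
    ∀ᵐ x, modeL2 a k x = (a * eigenfunction k x).re :=
  ContinuousMap.coeFn_toLp (𝕜 := ℝ) (p := 2) volume (modeFun a k)

lemma coeff_modeL2_eq (a : ℂ) (k j : Fin d → ℤ) :
    coeff (modeL2 a k) j = (if k = j then a / 2 else 0) + (if k = -j then conj a / 2 else 0) := by
  have hx : coeff (modeL2 a k) j = ∫ x : Torus d,
      (a / 2 * (eigenfunction k x * conj (eigenfunction j x)) +
        conj a / 2 * (eigenfunction (-k) x * conj (eigenfunction j x))) := by
    refine integral_congr_ae ?_
    filter_upwards [coeFn_modeL2 a k] with x hx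
    rw [hx, Complex.re_eq_add_conj, eigenfunction_neg, map_mul]
    ring
  have hi : ∀ m : Fin d → ℤ,
      Integrable fun x : Torus d => eigenfunction m x * conj (eigenfunction j x) :=
    fun m => (by fun_prop : Continuous fun x : Torus d =>
      eigenfunction m x * conj (eigenfunction j x)).integrable_of_hasCompactSupport
        (HasCompactSupport.of_compactSpace _)
  rw [hx, integral_add ((hi _).const_mul _) ((hi _).const_mul _), integral_const_mul,
    integral_const_mul, integral_eigenfunction_mul_conj, integral_eigenfunction_mul_conj]
  simp [neg_eq_iff_eq_neg]

lemma realPart_smul_eigenfunctionLp (a : ℂ) (k : Fin d → ℤ) :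
    realPart d (a • eigenfunctionLp k) = modeL2 a k := by
  refine Lp.ext ?_
  filter_upwards [coeFn_realPart (a • eigenfunctionLp k), coeFn_modeL2 a k,
    Lp.coeFn_smul a (eigenfunctionLp k),
    ContinuousMap.coeFn_toLp (𝕜 := ℂ) (p := 2) volume (eigenfunction k)] with x h1 h2 h3 h4
  rw [h1, h2, h3, Pi.smul_apply, eigenfunctionLp, h4, smul_eq_mul]

/-- A Hermitian sequence, `c_{-k} = conj c_k`: the sequences of Fourier coefficients of real
functions. -/
def IsHermitianSeq (c : (Fin d → ℤ) → ℂ) : Prop := ∀ k, c (-k) = conj (c k)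

lemma isHermitianSeq_coeff (f : L2 d) : IsHermitianSeq (coeff f) := coeff_neg_index f

lemma IsHermitianSeq.hasSum_coeff_modeL2 {c : (Fin d → ℤ) → ℂ} (hc : IsHermitianSeq c)
    (j : Fin d → ℤ) : HasSum (fun k => coeff (modeL2 (c k) k) j) (c j) := by
  simp only [coeff_modeL2_eq]
  have h1 : HasSum (fun k => if k = j then c k / 2 else 0) (c j / 2) :=
    (hasSum_ite_eq j (c j / 2)).congr_fun fun k => by split_ifs <;> simp_all
  have h2 : HasSum (fun k => if k = -j then conj (c k) / 2 else 0) (c j / 2) := by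
    refine (hasSum_ite_eq (-j) (c j / 2)).congr_fun fun k => ?_
    split_ifs with h
    · rw [h, hc, Complex.conj_conj]
    · rfl
  simpa only [add_halves] using h1.add h2

lemma exists_hasSum_modeL2 {c : (Fin d → ℤ) → ℂ} (hc : IsHermitianSeq c)
    (hs : Summable fun k => ‖c k‖ ^ 2) :
    ∃ f : L2 d, HasSum (fun k => modeL2 (c k) k) f ∧ ∀ k, coeff f k = c k := by
  have hm : Memℓp c 2 := by
    rw [memℓp_gen_iff (by norm_num)]
    simpa using hs
  have h := ((eigenBasis d).hasSum_repr_symm ⟨c, hm⟩).mapL (realPart d)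
  simp only [eigenBasis_apply, realPart_smul_eigenfunctionLp] at h
  exact ⟨_, h, fun j => (h.mapL (coeffCLM j)).unique (hc.hasSum_coeff_modeL2 j)⟩

lemma hasSum_modeL2_coeff (f : L2 d) : HasSum (fun k => modeL2 (coeff f k) k) f := by
  obtain ⟨g, hg, hgc⟩ := exists_hasSum_modeL2 (isHermitianSeq_coeff f)
    (hasSum_norm_coeff_sq f).summable
  rwa [coeff_ext hgc] at hg

/-! ### Fourier series in `H¹` -/

lemma eigenvalue_nonneg (k : Fin d → ℤ) : 0 ≤ eigenvalue k :=
  Finset.sum_nonneg fun _ _ => sq_nonneg _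

lemma eigenvalue_neg (k : Fin d → ℤ) : eigenvalue (-k) = eigenvalue k := by
  simp [eigenvalue]

lemma one_add_eigenvalue_nonneg (k : Fin d → ℤ) : 0 ≤ 1 + eigenvalue k :=
  add_nonneg zero_le_one (eigenvalue_nonneg k)

lemma H1.hasSum_norm_sq (f : H1 d) :
    HasSum (fun k => (1 + eigenvalue k) * ‖coeff (toL2 f) k‖ ^ 2) (‖f‖ ^ 2) := by
  rw [H1.norm_sq]
  have h1 := hasSum_norm_coeff_sq (toL2 f)
  have h2 : Summable fun k : Fin d → ℤ => eigenvalue k * ‖coeff (toL2 f) k‖ ^ 2 :=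
    (mem_h1Submodule_iff (toL2 f)).mp f.2
  simpa only [add_mul, one_mul] using h1.add h2.hasSum

lemma toL2_injective : Function.Injective (toL2 (d := d)) := Subtype.val_injective

lemma H1.coeff_ext {f g : H1 d} (h : ∀ k, coeff (toL2 f) k = coeff (toL2 g) k) : f = g :=
  toL2_injective (BilinearWave.coeff_ext h)

lemma norm_toL2_le (f : H1 d) : ‖toL2 f‖ ≤ ‖f‖ := by
  refine (sq_le_sq₀ (norm_nonneg _) (norm_nonneg f)).mp ?_
  rw [H1.norm_sq]
  exact le_add_of_nonneg_right (tsum_nonneg fun k => mul_nonneg (eigenvalue_nonneg k) (sq_nonneg _))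

/-- The inclusion of `H¹` into `L²` as a continuous linear map. -/
def toL2CLM (d : ℕ) : H1 d →L[ℝ] L2 d :=
  toL2.mkContinuous 1 fun f => by simpa using norm_toL2_le f

lemma toL2_modeH1 (a : ℂ) (k : Fin d → ℤ) : toL2 (modeH1 a k) = modeL2 a k := rfl

lemma gradCoeff_apply (f : H1 d) (k : Fin d → ℤ) :
    gradCoeff f k = (Real.sqrt (eigenvalue k) : ℂ) * coeff (toL2 f) k := rfl

lemma gradCoeff_modeH1 (a : ℂ) (k : Fin d → ℤ) :
    gradCoeff (modeH1 a k) = lp.single 2 k ((Real.sqrt (eigenvalue k) : ℂ) * a / 2) +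
      lp.single 2 (-k) ((Real.sqrt (eigenvalue k) : ℂ) * conj a / 2) := by
  ext j
  simp only [gradCoeff_apply, toL2_modeH1, coeff_modeL2_eq, lp.coeFn_add, Pi.add_apply,
    lp.single_apply, Pi.single_apply, mul_add, eq_comm (a := k), ← neg_eq_iff_eq_neg (a := j)]
  congr 1
  · split_ifs with h
    · rw [h]; ring
    · simp
  · split_ifs with h
    · rw [← h, eigenvalue_neg]; ring
    · simp

lemma hasSum_gradCoeff_modeH1 (f : H1 d) :
    HasSum (fun k => gradCoeff (modeH1 (coeff (toL2 f) k) k)) (gradCoeff f) := by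
  have h1 := (lp.hasSum_single (E := fun _ : Fin d → ℤ => ℂ) (p := 2) (by simp)
    (gradCoeff f)).const_smul (2⁻¹ : ℂ)
  have h2 := (Equiv.neg (Fin d → ℤ)).hasSum_iff.mpr h1
  have h3 := h1.add h2
  rw [← add_smul] at h3
  norm_num at h3
  refine h3.congr_fun fun k => ?_
  rw [gradCoeff_modeH1]
  simp only [← lp.single_smul, smul_eq_mul, gradCoeff_apply, eigenvalue_neg, coeff_neg_index]
  congr 2 <;> ring

lemma hasSum_modeH1_coeff (f : H1 d) : HasSum (fun k => modeH1 (coeff (toL2 f) k) k) f := by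
  have hi : Topology.IsInducing (h1Embedding (d := d)) := ⟨rfl⟩
  refine (hi.hasSum_iff _ _).mp ?_
  exact ((hasSum_modeL2_coeff (toL2 f)).prodMk (hasSum_gradCoeff_modeH1 f)).mapL
    (WithLp.prodContinuousLinearEquiv 2 ℝ (L2 d)
      (lp (fun _ : Fin d → ℤ => ℂ) 2)).symm.toContinuousLinearMap

lemma exists_hasSum_modeH1 {c : (Fin d → ℤ) → ℂ} (hc : IsHermitianSeq c)
    (hs : Summable fun k => (1 + eigenvalue k) * ‖c k‖ ^ 2) :
    ∃ f : H1 d, HasSum (fun k => modeH1 (c k) k) f ∧ ∀ k, coeff (toL2 f) k = c k := by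
  have hl := fun k : Fin d → ℤ => mul_nonneg (eigenvalue_nonneg k) (sq_nonneg ‖c k‖)
  have hs1 : Summable fun k => ‖c k‖ ^ 2 :=
    hs.of_nonneg_of_le (fun k => sq_nonneg _) fun k => by linarith [hl k]
  have hs2 : Summable fun k => eigenvalue k * ‖c k‖ ^ 2 :=
    hs.of_nonneg_of_le hl fun k => by linarith [sq_nonneg ‖c k‖]
  obtain ⟨f, -, hf⟩ := exists_hasSum_modeL2 hc hs1
  let F : H1 d := ⟨f, (mem_h1Submodule_iff f).mpr (by simpa only [hf] using hs2)⟩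
  have hF : ∀ k, coeff (toL2 F) k = c k := hf
  exact ⟨F, by simpa only [hF] using hasSum_modeH1_coeff F, hF⟩

lemma norm_add_sq_le_two_mul {E : Type*} [SeminormedAddCommGroup E] (a b : E) :
    ‖a + b‖ ^ 2 ≤ 2 * ‖a‖ ^ 2 + 2 * ‖b‖ ^ 2 := by
  rw [← mul_add]
  exact (pow_le_pow_left₀ (norm_nonneg _) (norm_add_le a b) 2).trans add_sq_le

lemma norm_sub_sq_le_two_mul {E : Type*} [SeminormedAddCommGroup E] (a b : E) :
    ‖a - b‖ ^ 2 ≤ 2 * ‖a‖ ^ 2 + 2 * ‖b‖ ^ 2 := by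
  simpa [sub_eq_add_neg] using norm_add_sq_le_two_mul a (-b)

open Filter Topology in
lemma tendsto_of_dominated_coeff {E F ι α : Type*} [SeminormedAddCommGroup E]
    [SeminormedAddCommGroup F] {c : E → ι → F} {r : ι → ℝ} {l : Filter α} {u : α → E} {v : E}
    {b : ι → ℝ} (hsub : ∀ f g k, c (f - g) k = c f k - c g k) (hr : ∀ k, 0 ≤ r k)
    (hnorm : ∀ f, HasSum (fun k => r k * ‖c f k‖ ^ 2) (‖f‖ ^ 2))
    (hlim : ∀ k, Tendsto (fun t => c (u t) k) l (𝓝 (c v k))) (hb : Summable b)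
    (hle : ∀ᶠ t in l, ∀ k, r k * ‖c (u t) k‖ ^ 2 ≤ b k) : Tendsto u l (𝓝 v) := by
  have hsum : Tendsto (fun t => ∑' k, r k * ‖c (u t) k - c v k‖ ^ 2) l
      (𝓝 (∑' _ : ι, (0 : ℝ))) := by
    refine tendsto_tsum_of_dominated_convergence
      (bound := fun k => 2 * b k + 2 * (r k * ‖c v k‖ ^ 2))
      ((hb.mul_left 2).add ((hnorm v).summable.mul_left 2)) (fun k => ?_) ?_
    · simpa using (((hlim k).sub_const (c v k)).norm.pow 2).const_mul (r k)
    · filter_upwards [hle] with t ht k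
      rw [Real.norm_of_nonneg (mul_nonneg (hr k) (sq_nonneg _))]
      have h := mul_le_mul_of_nonneg_left (norm_sub_sq_le_two_mul (c (u t) k) (c v k)) (hr k)
      linarith [ht k]
  have hsq : Tendsto (fun t => ‖u t - v‖ ^ 2) l (𝓝 0) := by
    rw [tsum_zero] at hsum
    refine hsum.congr fun t => ?_
    rw [← (hnorm (u t - v)).tsum_eq]
    simp only [hsub]
  exact tendsto_iff_norm_sub_tendsto_zero.mpr (by simpa using hsq.sqrt)

/-! ### The free evolution -/

/-- The multiplier `sin (√λ t) / √λ` (`t` for `λ = 0`), by which the free evolution carries the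
velocity into the profile at frequency `√λ`. -/
def sineMultiplier (lam t : ℝ) : ℝ := t * Real.sinc (Real.sqrt lam * t)

/-- The multiplier `cos (√λ t)` of the free evolution. -/
def cosMultiplier (lam t : ℝ) : ℝ := Real.cos (Real.sqrt lam * t)

lemma sqrt_mul_sineMultiplier (lam t : ℝ) :
    Real.sqrt lam * sineMultiplier lam t = Real.sin (Real.sqrt lam * t) := by
  unfold sineMultiplier
  by_cases h : Real.sqrt lam * t = 0
  · rw [h, Real.sinc_zero, Real.sin_zero, mul_one, h]
  · rw [Real.sinc_of_ne_zero h, ← mul_assoc, mul_div_cancel₀ _ h]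

lemma mul_sineMultiplier {lam : ℝ} (hl : 0 ≤ lam) (t : ℝ) :
    lam * sineMultiplier lam t = Real.sqrt lam * Real.sin (Real.sqrt lam * t) := by
  rw [← sqrt_mul_sineMultiplier, ← mul_assoc, Real.mul_self_sqrt hl]

lemma sineMultiplier_sq_le (lam t : ℝ) : sineMultiplier lam t ^ 2 ≤ t ^ 2 := by
  rw [sq_le_sq, sineMultiplier, abs_mul]
  exact mul_le_of_le_one_right (abs_nonneg t) (Real.abs_sinc_le_one _)

lemma mul_sineMultiplier_sq_le_one {lam : ℝ} (hl : 0 ≤ lam) (t : ℝ) :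
    lam * sineMultiplier lam t ^ 2 ≤ 1 := by
  have h := Real.sin_sq_le_one (Real.sqrt lam * t)
  rwa [← sqrt_mul_sineMultiplier, mul_pow, Real.sq_sqrt hl] at h

lemma cosMultiplier_sq_le_one (lam t : ℝ) : cosMultiplier lam t ^ 2 ≤ 1 := Real.cos_sq_le_one _

lemma sineMultiplier_add (lam s t : ℝ) : sineMultiplier lam (s + t) =
    sineMultiplier lam s * cosMultiplier lam t + cosMultiplier lam s * sineMultiplier lam t := by
  by_cases h : Real.sqrt lam = 0
  · simp [sineMultiplier, cosMultiplier, h]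
  · apply mul_left_cancel₀ h
    rw [sqrt_mul_sineMultiplier, mul_add, Real.sin_add, ← sqrt_mul_sineMultiplier,
      ← sqrt_mul_sineMultiplier, cosMultiplier, cosMultiplier]
    ring

lemma cosMultiplier_add {lam : ℝ} (hl : 0 ≤ lam) (s t : ℝ) : cosMultiplier lam (s + t) =
    cosMultiplier lam s * cosMultiplier lam t -
      lam * (sineMultiplier lam s * sineMultiplier lam t) := by
  rw [cosMultiplier, mul_add, Real.cos_add, ← sqrt_mul_sineMultiplier, ← sqrt_mul_sineMultiplier]
  simp only [cosMultiplier]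
  linear_combination (-sineMultiplier lam s * sineMultiplier lam t) * Real.sq_sqrt hl

@[fun_prop]
lemma continuous_sineMultiplier (lam : ℝ) : Continuous (sineMultiplier lam) :=
  continuous_id.mul (Real.continuous_sinc.comp (continuous_const.mul continuous_id))

@[fun_prop]
lemma continuous_cosMultiplier (lam : ℝ) : Continuous (cosMultiplier lam) :=
  Real.continuous_cos.comp (continuous_const.mul continuous_id)

lemma norm_ofReal_mul_sq (r : ℝ) (z : ℂ) : ‖(r : ℂ) * z‖ ^ 2 = r ^ 2 * ‖z‖ ^ 2 := by
  rw [norm_mul, mul_pow, Complex.norm_real, Real.norm_eq_abs, sq_abs]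

/-- The Fourier coefficients of the profile of the free evolution of `W` at time `t`. -/
def profileCoeff (t : ℝ) (W : State d) (k : Fin d → ℤ) : ℂ :=
  cosMultiplier (eigenvalue k) t * coeff (toL2 W.1) k +
    sineMultiplier (eigenvalue k) t * coeff W.2 k

/-- The Fourier coefficients of the velocity of the free evolution of `W` at time `t`. -/
def velocityCoeff (t : ℝ) (W : State d) (k : Fin d → ℤ) : ℂ :=
  -((eigenvalue k * sineMultiplier (eigenvalue k) t : ℝ) * coeff (toL2 W.1) k) +
    cosMultiplier (eigenvalue k) t * coeff W.2 k

lemma one_add_eigenvalue_mul_norm_profileCoeff_sq_le (t : ℝ) (W : State d) (k : Fin d → ℤ) :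
    (1 + eigenvalue k) * ‖profileCoeff t W k‖ ^ 2 ≤
      2 * ((1 + eigenvalue k) * ‖coeff (toL2 W.1) k‖ ^ 2) +
        2 * (1 + t ^ 2) * ‖coeff W.2 k‖ ^ 2 := by
  set lam := eigenvalue k
  have hl : 0 ≤ lam := eigenvalue_nonneg k
  have h := norm_add_sq_le_two_mul (cosMultiplier lam t * coeff (toL2 W.1) k)
    (sineMultiplier lam t * coeff W.2 k)
  rw [norm_ofReal_mul_sq, norm_ofReal_mul_sq] at h
  have hc := cosMultiplier_sq_le_one lam t
  have hs : (1 + lam) * sineMultiplier lam t ^ 2 ≤ 1 + t ^ 2 := by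
    linarith [mul_sineMultiplier_sq_le_one hl t, sineMultiplier_sq_le lam t]
  calc (1 + lam) * ‖profileCoeff t W k‖ ^ 2
      ≤ (1 + lam) * (2 * (cosMultiplier lam t ^ 2 * ‖coeff (toL2 W.1) k‖ ^ 2) +
        2 * (sineMultiplier lam t ^ 2 * ‖coeff W.2 k‖ ^ 2)) :=
        mul_le_mul_of_nonneg_left h (by positivity)
    _ = 2 * ((1 + lam) * (cosMultiplier lam t ^ 2 * ‖coeff (toL2 W.1) k‖ ^ 2)) +
        2 * ((1 + lam) * sineMultiplier lam t ^ 2) * ‖coeff W.2 k‖ ^ 2 := by ring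
    _ ≤ _ := by
      gcongr
      exact mul_le_of_le_one_left (sq_nonneg _) hc

lemma norm_velocityCoeff_sq_le (t : ℝ) (W : State d) (k : Fin d → ℤ) :
    ‖velocityCoeff t W k‖ ^ 2 ≤ 2 * ((1 + eigenvalue k) * ‖coeff (toL2 W.1) k‖ ^ 2) +
      2 * ‖coeff W.2 k‖ ^ 2 := by
  set lam := eigenvalue k
  have hl : 0 ≤ lam := eigenvalue_nonneg k
  have h := norm_add_sq_le_two_mul (-((lam * sineMultiplier lam t : ℝ) * coeff (toL2 W.1) k))
    (cosMultiplier lam t * coeff W.2 k)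
  rw [norm_neg, norm_ofReal_mul_sq, norm_ofReal_mul_sq] at h
  have hs : (lam * sineMultiplier lam t) ^ 2 ≤ 1 + lam := by
    nlinarith [mul_sineMultiplier_sq_le_one hl t]
  refine h.trans ?_
  gcongr
  exact mul_le_of_le_one_left (sq_nonneg _) (cosMultiplier_sq_le_one lam t)

lemma State.summable_norm_coeff_sq (C : ℝ) (W : State d) :
    Summable fun k => 2 * ((1 + eigenvalue k) * ‖coeff (toL2 W.1) k‖ ^ 2) +
      C * ‖coeff W.2 k‖ ^ 2 :=
  ((H1.hasSum_norm_sq W.1).summable.mul_left 2).add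
    ((hasSum_norm_coeff_sq W.2).summable.mul_left _)

lemma isHermitianSeq_profileCoeff (t : ℝ) (W : State d) : IsHermitianSeq (profileCoeff t W) :=
  fun k => by simp [profileCoeff, eigenvalue_neg, coeff_neg_index]

lemma isHermitianSeq_velocityCoeff (t : ℝ) (W : State d) : IsHermitianSeq (velocityCoeff t W) :=
  fun k => by simp [velocityCoeff, eigenvalue_neg, coeff_neg_index]

lemma coeff_freeEvolution_fst (t : ℝ) (W : State d) (k : Fin d → ℤ) :
    coeff (toL2 (freeEvolution t W).1) k = profileCoeff t W k := by
  obtain ⟨f, hf, hfc⟩ := exists_hasSum_modeH1 (isHermitianSeq_profileCoeff t W)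
    ((State.summable_norm_coeff_sq _ W).of_nonneg_of_le
      (fun k => mul_nonneg (one_add_eigenvalue_nonneg k) (sq_nonneg _))
      (one_add_eigenvalue_mul_norm_profileCoeff_sq_le t W))
  have h : (freeEvolution t W).1 = f := by
    rw [← hf.tsum_eq]
    refine tsum_congr fun k => ?_
    simp only [profileCoeff, cosMultiplier, sineMultiplier]
    congr 1
    ring
  rw [h, hfc]

lemma coeff_freeEvolution_snd (t : ℝ) (W : State d) (k : Fin d → ℤ) :
    coeff (freeEvolution t W).2 k = velocityCoeff t W k := by
  obtain ⟨f, hf, hfc⟩ := exists_hasSum_modeL2 (isHermitianSeq_velocityCoeff t W)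
    ((State.summable_norm_coeff_sq _ W).of_nonneg_of_le (fun k => sq_nonneg _)
      (norm_velocityCoeff_sq_le t W))
  have h : (freeEvolution t W).2 = f := by
    rw [← hf.tsum_eq]
    refine tsum_congr fun k => ?_
    simp only [velocityCoeff, mul_sineMultiplier (eigenvalue_nonneg k), cosMultiplier]
    congr 1
    push_cast
    ring
  rw [h, hfc]

lemma State.coeff_ext {V W : State d} (h1 : ∀ k, coeff (toL2 V.1) k = coeff (toL2 W.1) k)
    (h2 : ∀ k, coeff V.2 k = coeff W.2 k) : V = W :=
  Prod.ext (H1.coeff_ext h1) (BilinearWave.coeff_ext h2)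

lemma freeEvolution_add (t : ℝ) (V W : State d) :
    freeEvolution t (V + W) = freeEvolution t V + freeEvolution t W := by
  refine State.coeff_ext (fun k => ?_) (fun k => ?_) <;>
  · simp only [Prod.fst_add, Prod.snd_add, map_add, coeff_add, coeff_freeEvolution_fst,
      coeff_freeEvolution_snd, profileCoeff, velocityCoeff]
    ring

lemma freeEvolution_smul (t c : ℝ) (W : State d) :
    freeEvolution t (c • W) = c • freeEvolution t W := by
  refine State.coeff_ext (fun k => ?_) (fun k => ?_) <;>
  · simp only [Prod.smul_fst, Prod.smul_snd, map_smul, coeff_smul, coeff_freeEvolution_fst,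
      coeff_freeEvolution_snd, profileCoeff, velocityCoeff]
    ring

lemma norm_freeEvolution_fst_sq_le (t : ℝ) (W : State d) :
    ‖(freeEvolution t W).1‖ ^ 2 ≤ 2 * ‖W.1‖ ^ 2 + 2 * (1 + t ^ 2) * ‖W.2‖ ^ 2 := by
  refine hasSum_le (fun k => ?_) (H1.hasSum_norm_sq _)
    (((H1.hasSum_norm_sq W.1).mul_left 2).add ((hasSum_norm_coeff_sq W.2).mul_left _))
  rw [coeff_freeEvolution_fst]
  exact one_add_eigenvalue_mul_norm_profileCoeff_sq_le t W k

lemma norm_freeEvolution_snd_sq_le (t : ℝ) (W : State d) :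
    ‖(freeEvolution t W).2‖ ^ 2 ≤ 2 * ‖W.1‖ ^ 2 + 2 * ‖W.2‖ ^ 2 := by
  refine hasSum_le (fun k => ?_) (hasSum_norm_coeff_sq _)
    (((H1.hasSum_norm_sq W.1).mul_left 2).add ((hasSum_norm_coeff_sq W.2).mul_left _))
  rw [coeff_freeEvolution_snd]
  exact norm_velocityCoeff_sq_le t W k

lemma norm_freeEvolution_le (t : ℝ) (W : State d) :
    ‖freeEvolution t W‖ ≤ (2 + 2 * |t|) * ‖W‖ := by
  have h1 : ‖W.1‖ ^ 2 ≤ ‖W‖ ^ 2 := pow_le_pow_left₀ (norm_nonneg _) (norm_fst_le W) 2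
  have h2 : ‖W.2‖ ^ 2 ≤ ‖W‖ ^ 2 := pow_le_pow_left₀ (norm_nonneg _) (norm_snd_le W) 2
  have ht : t ^ 2 = |t| ^ 2 := (sq_abs t).symm
  have h0 := abs_nonneg t
  have hr : 0 ≤ (2 + 2 * |t|) * ‖W‖ := by positivity
  have hs : 2 * ‖W‖ ^ 2 + 2 * (1 + t ^ 2) * ‖W‖ ^ 2 ≤ ((2 + 2 * |t|) * ‖W‖) ^ 2 := by
    rw [ht, mul_pow]
    nlinarith [sq_nonneg ‖W‖, mul_nonneg h0 (sq_nonneg ‖W‖),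
      mul_nonneg (sq_nonneg |t|) (sq_nonneg ‖W‖)]
  refine max_le ?_ ?_
  · refine (sq_le_sq₀ (norm_nonneg _) hr).mp
      ((norm_freeEvolution_fst_sq_le t W).trans (le_trans ?_ hs))
    gcongr
  · refine (sq_le_sq₀ (norm_nonneg _) hr).mp
      ((norm_freeEvolution_snd_sq_le t W).trans (le_trans ?_ hs))
    have : 2 * ‖W.2‖ ^ 2 ≤ 2 * (1 + t ^ 2) * ‖W‖ ^ 2 := by
      nlinarith [mul_nonneg (sq_nonneg t) (sq_nonneg ‖W‖)]
    linarith

/-- The free evolution `e^{t𝒜}` as a continuous linear map. -/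
def freeCLM (t : ℝ) : State d →L[ℝ] State d :=
  LinearMap.mkContinuous
    { toFun := freeEvolution t
      map_add' := freeEvolution_add t
      map_smul' := freeEvolution_smul t }
    (2 + 2 * |t|) (norm_freeEvolution_le t)

lemma freeCLM_apply (t : ℝ) (W : State d) : freeCLM t W = freeEvolution t W := rfl

lemma norm_freeCLM_le (t : ℝ) : ‖freeCLM (d := d) t‖ ≤ 2 + 2 * |t| :=
  LinearMap.mkContinuous_norm_le _ (by positivity) _

lemma freeCLM_zero (W : State d) : freeCLM 0 W = W := by
  refine State.coeff_ext (fun k => ?_) (fun k => ?_) <;>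
  simp [freeCLM_apply, coeff_freeEvolution_fst, coeff_freeEvolution_snd, profileCoeff,
    velocityCoeff, sineMultiplier, cosMultiplier]

lemma freeCLM_add (s t : ℝ) (W : State d) : freeCLM (s + t) W = freeCLM s (freeCLM t W) := by
  refine State.coeff_ext (fun k => ?_) (fun k => ?_) <;>
  · simp only [freeCLM_apply, coeff_freeEvolution_fst, coeff_freeEvolution_snd, profileCoeff,
      velocityCoeff, sineMultiplier_add, cosMultiplier_add (eigenvalue_nonneg k)]
    push_cast
    ring

lemma continuous_freeCLM_apply_fst (W : State d) : Continuous fun t => (freeCLM t W).1 := by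
  rw [continuous_iff_continuousAt]
  intro t₀
  refine tendsto_of_dominated_coeff (c := fun f k => coeff (toL2 f) k)
    (fun f g k => by rw [map_sub, coeff_sub]) one_add_eigenvalue_nonneg H1.hasSum_norm_sq
    (fun k => ?_) (State.summable_norm_coeff_sq (2 * (1 + (t₀ ^ 2 + 1))) W) ?_
  · simp only [freeCLM_apply, coeff_freeEvolution_fst, profileCoeff]
    exact Continuous.tendsto (by fun_prop) t₀
  · have ht₀ : ∀ᶠ t in nhds t₀, t ^ 2 < t₀ ^ 2 + 1 :=
      (continuous_pow 2).continuousAt.eventually_lt_const (lt_add_one _)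
    filter_upwards [ht₀] with t ht k
    rw [freeCLM_apply, coeff_freeEvolution_fst]
    refine (one_add_eigenvalue_mul_norm_profileCoeff_sq_le t W k).trans ?_
    gcongr

lemma continuous_freeCLM_apply_snd (W : State d) : Continuous fun t => (freeCLM t W).2 := by
  rw [continuous_iff_continuousAt]
  intro t₀
  refine tendsto_of_dominated_coeff (c := coeff) (r := fun _ => 1) coeff_sub
    (fun _ => zero_le_one) (fun f => by simpa using hasSum_norm_coeff_sq f)
    (fun k => ?_) (State.summable_norm_coeff_sq 2 W) ?_
  · simp only [freeCLM_apply, coeff_freeEvolution_snd, velocityCoeff]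
    exact Continuous.tendsto (by fun_prop) t₀
  · filter_upwards with t k
    rw [freeCLM_apply, coeff_freeEvolution_snd, one_mul]
    exact norm_velocityCoeff_sq_le t W k

lemma continuous_freeCLM_apply (W : State d) : Continuous fun t => freeCLM t W :=
  (continuous_freeCLM_apply_fst W).prodMk (continuous_freeCLM_apply_snd W)

/-! ### Multiplication operators and impulses -/

lemma coeFn_mulL2 (V : C(Torus d, ℝ)) (f : L2 d) : ∀ᵐ x, mulL2 V f x = V x * f x :=
  MemLp.coeFn_toLp _

lemma mulL2_add (V : C(Torus d, ℝ)) (f g : L2 d) : mulL2 V (f + g) = mulL2 V f + mulL2 V g := by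
  refine Lp.ext ?_
  filter_upwards [coeFn_mulL2 V (f + g), coeFn_mulL2 V f, coeFn_mulL2 V g, Lp.coeFn_add f g,
    Lp.coeFn_add (mulL2 V f) (mulL2 V g)] with x hVfg hVf hVg hfg hsum
  rw [hVfg, hsum, Pi.add_apply, hVf, hVg, hfg, Pi.add_apply, mul_add]

lemma mulL2_smul (V : C(Torus d, ℝ)) (c : ℝ) (f : L2 d) : mulL2 V (c • f) = c • mulL2 V f := by
  refine Lp.ext ?_
  filter_upwards [coeFn_mulL2 V (c • f), coeFn_mulL2 V f, Lp.coeFn_smul c f,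
    Lp.coeFn_smul c (mulL2 V f)] with x hVcf hVf hcf hcVf
  rw [hVcf, hcVf, Pi.smul_apply, hVf, hcf, Pi.smul_apply, mul_smul_comm]

lemma add_mulL2 (V V' : C(Torus d, ℝ)) (f : L2 d) :
    mulL2 (V + V') f = mulL2 V f + mulL2 V' f := by
  refine Lp.ext ?_
  filter_upwards [coeFn_mulL2 (V + V') f, coeFn_mulL2 V f, coeFn_mulL2 V' f,
    Lp.coeFn_add (mulL2 V f) (mulL2 V' f)] with x hsum hV hV' hadd
  rw [hsum, hadd, Pi.add_apply, hV, hV', ContinuousMap.add_apply, add_mul]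

lemma smul_mulL2 (c : ℝ) (V : C(Torus d, ℝ)) (f : L2 d) : mulL2 (c • V) f = c • mulL2 V f := by
  refine Lp.ext ?_
  filter_upwards [coeFn_mulL2 (c • V) f, coeFn_mulL2 V f, Lp.coeFn_smul c (mulL2 V f)]
    with x hcV hV hsmul
  rw [hcV, hsmul, Pi.smul_apply, hV, ContinuousMap.smul_apply, smul_mul_assoc]

lemma mulL2_mulL2 (V V' : C(Torus d, ℝ)) (f : L2 d) : mulL2 V (mulL2 V' f) = mulL2 (V * V') f := by
  refine Lp.ext ?_
  filter_upwards [coeFn_mulL2 V (mulL2 V' f), coeFn_mulL2 V' f, coeFn_mulL2 (V * V') f]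
    with x hV hV' hVV'
  rw [hV, hV', hVV', ContinuousMap.mul_apply, mul_assoc]

lemma norm_mulL2_le (V : C(Torus d, ℝ)) (f : L2 d) : ‖mulL2 V f‖ ≤ ‖V‖ * ‖f‖ := by
  refine Lp.norm_le_mul_norm_of_ae_le_mul ?_
  filter_upwards [coeFn_mulL2 V f] with x hx
  rw [hx, norm_mul]
  exact mul_le_mul_of_nonneg_right (V.norm_coe_le_norm x) (norm_nonneg _)

/-- Multiplication by a continuous function, as a continuous linear map of `L²`. -/
def mulCLM (V : C(Torus d, ℝ)) : L2 d →L[ℝ] L2 d :=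
  LinearMap.mkContinuous
    { toFun := mulL2 V, map_add' := mulL2_add V, map_smul' := mulL2_smul V } ‖V‖ (norm_mulL2_le V)

/-- The operator `controlOp V : (w, v) ↦ (0, V w)` as a continuous linear map. -/
def controlCLM (V : C(Torus d, ℝ)) : State d →L[ℝ] State d :=
  ContinuousLinearMap.inr ℝ (H1 d) (L2 d) ∘L mulCLM V ∘L toL2CLM d ∘L
    ContinuousLinearMap.fst ℝ (H1 d) (L2 d)

lemma controlCLM_apply (V : C(Torus d, ℝ)) (W : State d) :
    controlCLM V W = (0, mulL2 V (toL2 W.1)) := rfl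

lemma norm_controlCLM_apply_le (V : C(Torus d, ℝ)) (W : State d) :
    ‖controlCLM V W‖ ≤ ‖V‖ * ‖toL2 W.1‖ := by
  rw [controlCLM_apply, Prod.norm_mk, norm_zero, max_eq_right (norm_nonneg _)]
  exact norm_mulL2_le V _

lemma controlCLM_comp (V V' : C(Torus d, ℝ)) (W : State d) :
    controlCLM V (controlCLM V' W) = 0 := by
  have hV : mulL2 V 0 = 0 := (mulCLM V).map_zero
  simp [controlCLM_apply, hV]

lemma controlCLM_add (V V' : C(Torus d, ℝ)) (W : State d) :
    controlCLM (V + V') W = controlCLM V W + controlCLM V' W := by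
  simp [controlCLM_apply, add_mulL2]

lemma controlCLM_smul (c : ℝ) (V : C(Torus d, ℝ)) : controlCLM (c • V) = c • controlCLM V := by
  refine ContinuousLinearMap.ext fun W => ?_
  simp [controlCLM_apply, smul_mulL2]

lemma isStronglyContinuousGroup_freeCLM : IsStronglyContinuousGroup (freeCLM (d := d)) where
  zero_apply := freeCLM_zero
  add_apply := freeCLM_add
  continuous_apply := continuous_freeCLM_apply
  bounded T := ⟨2 + 2 * |T|, by positivity, fun t ht => (norm_freeCLM_le t).trans (by
    linarith [ht.trans (le_abs_self T)])⟩

/-- The perturbation of the free evolution caused by given control values. -/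
def waveControl (c : Fin (2 * d + 1) → ℝ) : State d →L[ℝ] State d := controlCLM (potential c)

lemma waveControl_smul (s : ℝ) (c : Fin (2 * d + 1) → ℝ) :
    waveControl (s • c) = s • waveControl c := by
  rw [waveControl, waveControl, ← controlCLM_smul]
  simp [potential, Finset.smul_sum, smul_smul]

lemma waveControl_zero : waveControl (0 : Fin (2 * d + 1) → ℝ) = 0 := by
  simpa using waveControl_smul (d := d) 0 0

/-- The impulse `(w, v) ↦ (w, v + φ w)` can be realised approximately in arbitrarily small time. -/
def Impulsive (φ : C(Torus d, ℝ)) : Prop :=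
  ∀ (W : State d) (η : ℝ), 0 < η → SteersTo freeCLM waveControl η W (W + controlCLM φ W)

lemma impulsive_potential (c : Fin (2 * d + 1) → ℝ) : Impulsive (potential c) := fun W _ hη =>
  steersTo_impulse isStronglyContinuousGroup_freeCLM (controlCLM_comp _ _)
    (fun δ _ => ⟨δ⁻¹ • c, waveControl_smul _ c⟩) hη W

lemma Impulsive.add {φ ψ : C(Torus d, ℝ)} (hφ : Impulsive φ) (hψ : Impulsive ψ) :
    Impulsive (φ + ψ) := fun W η hη => by
  have h := (hφ W (η / 2) (half_pos hη)).trans isStronglyContinuousGroup_freeCLM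
    (hψ _ (η / 2) (half_pos hη))
  rwa [map_add, controlCLM_comp, add_zero, add_assoc, ← controlCLM_add, add_halves] at h

/-! ### Conjugating the free evolution by opposite impulses -/

section Conjugation

open Filter Topology

/-- Multiplication by `φ` maps `H¹` into itself. -/
def PreservesH1 (φ : C(Torus d, ℝ)) : Prop := ∀ f : H1 d, mulL2 φ (toL2 f) ∈ h1Submodule d

lemma PreservesH1.add {φ ψ : C(Torus d, ℝ)} (hφ : PreservesH1 φ) (hψ : PreservesH1 ψ) :
    PreservesH1 (φ + ψ) := fun f => by
  rw [add_mulL2]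
  exact Submodule.add_mem _ (hφ f) (hψ f)

lemma abs_sinc_sub_one_le (x : ℝ) : |Real.sinc x - 1| ≤ |x| := by
  rcases eq_or_ne x 0 with rfl | hx
  · simp
  have hpos : 0 < |x| := abs_pos.mpr hx
  rcases le_total |x| 6 with hx6 | hx6
  · rw [Real.sinc_of_ne_zero hx, div_sub_one hx, abs_div, div_le_iff₀ hpos, abs_sub_comm]
    refine (Real.abs_sub_sin_le x).trans ?_
    nlinarith [mul_nonneg hpos.le hpos.le]
  · calc |Real.sinc x - 1| ≤ |Real.sinc x| + |1| := abs_sub _ _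
      _ ≤ |x| := by
        rw [abs_one]
        linarith [Real.abs_sinc_le_one x]

lemma cosMultiplier_sub_one_sq_le {lam : ℝ} (hl : 0 ≤ lam) (t : ℝ) :
    (cosMultiplier lam t - 1) ^ 2 ≤ t ^ 2 * lam := by
  have h := sq_le_sq.mpr (Real.abs_cos_sub_cos_le (Real.sqrt lam * t) 0)
  rwa [Real.cos_zero, sub_zero, mul_pow, Real.sq_sqrt hl, mul_comm lam] at h

lemma inv_mul_sineMultiplier_sub_one_sq_le {lam t : ℝ} (hl : 0 ≤ lam) (ht : t ≠ 0) :
    (t⁻¹ * sineMultiplier lam t - 1) ^ 2 ≤ t ^ 2 * lam := by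
  have h := sq_le_sq.mpr (abs_sinc_sub_one_le (Real.sqrt lam * t))
  rwa [mul_pow, Real.sq_sqrt hl, mul_comm lam, ← inv_mul_cancel_left₀ ht (Real.sinc _)] at h

lemma coeff_freeCLM_inr_fst (t : ℝ) (v : L2 d) (k : Fin d → ℤ) :
    coeff (toL2 (freeCLM t ((0 : H1 d), v)).1) k = sineMultiplier (eigenvalue k) t * coeff v k := by
  rw [freeCLM_apply, coeff_freeEvolution_fst, profileCoeff]
  simp only [map_zero, coeff_zero, mul_zero, zero_add]

lemma coeff_freeCLM_inr_snd (t : ℝ) (v : L2 d) (k : Fin d → ℤ) :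
    coeff (freeCLM t ((0 : H1 d), v)).2 k = cosMultiplier (eigenvalue k) t * coeff v k := by
  rw [freeCLM_apply, coeff_freeEvolution_snd, velocityCoeff]
  simp only [map_zero, coeff_zero, mul_zero, neg_zero, zero_add]

lemma norm_freeCLM_inr_fst_le (t : ℝ) (g : H1 d) :
    ‖(freeCLM t ((0 : H1 d), toL2 g)).1‖ ≤ |t| * ‖g‖ := by
  refine (sq_le_sq₀ (norm_nonneg _) (by positivity)).mp ?_
  rw [mul_pow, sq_abs]
  refine hasSum_le (fun k => ?_) (H1.hasSum_norm_sq _) ((H1.hasSum_norm_sq g).mul_left _)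
  rw [coeff_freeCLM_inr_fst, norm_ofReal_mul_sq, mul_left_comm]
  exact mul_le_mul_of_nonneg_right (sineMultiplier_sq_le _ t)
    (mul_nonneg (one_add_eigenvalue_nonneg k) (sq_nonneg _))

lemma norm_le_abs_mul_of_coeff_eq {t : ℝ} {f : L2 d} {g : H1 d} {r : (Fin d → ℤ) → ℝ}
    (hf : ∀ k, coeff f k = r k * coeff (toL2 g) k) (hr : ∀ k, r k ^ 2 ≤ t ^ 2 * eigenvalue k) :
    ‖f‖ ≤ |t| * ‖g‖ := by
  refine (sq_le_sq₀ (norm_nonneg _) (by positivity)).mp ?_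
  rw [mul_pow, sq_abs]
  refine hasSum_le (fun k => ?_) (hasSum_norm_coeff_sq _) ((H1.hasSum_norm_sq g).mul_left _)
  rw [hf, norm_ofReal_mul_sq, ← mul_assoc]
  refine mul_le_mul_of_nonneg_right ((hr k).trans ?_) (sq_nonneg _)
  gcongr
  linarith

lemma norm_freeCLM_inr_sub_le (t : ℝ) (g : H1 d) :
    ‖freeCLM t ((0 : H1 d), toL2 g) - (0, toL2 g)‖ ≤ |t| * ‖g‖ := by
  refine max_le ?_ (norm_le_abs_mul_of_coeff_eq
    (r := fun k => cosMultiplier (eigenvalue k) t - 1) (fun k => ?_)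
    fun k => cosMultiplier_sub_one_sq_le (eigenvalue_nonneg k) t)
  · simpa only [Prod.fst_sub, sub_zero] using norm_freeCLM_inr_fst_le t g
  · rw [Prod.snd_sub, coeff_sub, coeff_freeCLM_inr_snd]
    push_cast
    ring

lemma norm_inv_smul_freeCLM_inr_fst_sub_le {t : ℝ} (ht : t ≠ 0) (g : H1 d) :
    ‖toL2 (t⁻¹ • freeCLM t ((0 : H1 d), toL2 g) - (g, 0)).1‖ ≤ |t| * ‖g‖ := by
  refine norm_le_abs_mul_of_coeff_eq
    (r := fun k => t⁻¹ * sineMultiplier (eigenvalue k) t - 1) (fun k => ?_)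
    fun k => inv_mul_sineMultiplier_sub_one_sq_le (eigenvalue_nonneg k) ht
  rw [Prod.fst_sub, map_sub, coeff_sub, Prod.smul_fst, map_smul, coeff_smul, coeff_freeCLM_inr_fst]
  push_cast
  ring

lemma norm_toL2_freeCLM_sub_fst_le (t : ℝ) (W : State d) :
    ‖toL2 (freeCLM t W - W).1‖ ≤ 2 * ‖W‖ * |t| := by
  have hcoeff : ∀ k, coeff (toL2 (freeCLM t W - W).1) k =
      ((cosMultiplier (eigenvalue k) t - 1 : ℝ) : ℂ) * coeff (toL2 W.1) k +
        sineMultiplier (eigenvalue k) t * coeff W.2 k := fun k => by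
    rw [Prod.fst_sub, map_sub, coeff_sub, freeCLM_apply, coeff_freeEvolution_fst, profileCoeff]
    push_cast
    ring
  have hsq : ‖toL2 (freeCLM t W - W).1‖ ^ 2 ≤
      2 * t ^ 2 * ‖W.1‖ ^ 2 + 2 * t ^ 2 * ‖W.2‖ ^ 2 := by
    refine hasSum_le (fun k => ?_) (hasSum_norm_coeff_sq _)
      (((H1.hasSum_norm_sq W.1).mul_left _).add ((hasSum_norm_coeff_sq W.2).mul_left _))
    rw [hcoeff]
    refine (norm_add_sq_le_two_mul _ _).trans ?_
    have hcos : (cosMultiplier (eigenvalue k) t - 1) ^ 2 ≤ t ^ 2 * (1 + eigenvalue k) :=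
      (cosMultiplier_sub_one_sq_le (eigenvalue_nonneg k) t).trans (by gcongr; linarith)
    have hsin : sineMultiplier (eigenvalue k) t ^ 2 ≤ t ^ 2 := sineMultiplier_sq_le _ t
    rw [norm_ofReal_mul_sq, norm_ofReal_mul_sq, mul_assoc 2, mul_assoc 2, ← mul_assoc (t ^ 2)]
    exact add_le_add
      (mul_le_mul_of_nonneg_left (mul_le_mul_of_nonneg_right hcos (sq_nonneg _)) zero_le_two)
      (mul_le_mul_of_nonneg_left (mul_le_mul_of_nonneg_right hsin (sq_nonneg _)) zero_le_two)
  refine (sq_le_sq₀ (norm_nonneg _) (by positivity)).mp (hsq.trans ?_)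
  calc 2 * t ^ 2 * ‖W.1‖ ^ 2 + 2 * t ^ 2 * ‖W.2‖ ^ 2
      ≤ 2 * t ^ 2 * ‖W‖ ^ 2 + 2 * t ^ 2 * ‖W‖ ^ 2 := by
        gcongr
        exacts [norm_fst_le W, norm_snd_le W]
    _ = (2 * ‖W‖ * |t|) ^ 2 := by
        rw [mul_pow, sq_abs]
        ring

lemma tendsto_inv_sqrt_smul {E : Type*} [SeminormedAddCommGroup E] [NormedSpace ℝ E] {f : ℝ → E}
    {C : ℝ} (hf : ∀ t, ‖f t‖ ≤ C * |t|) :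
    Tendsto (fun t : ℝ => (√t)⁻¹ • f t) (𝓝[>] 0) (𝓝 0) := by
  have hlim : Tendsto (fun t : ℝ => C * √t) (𝓝[>] 0) (𝓝 0) := by
    have h : Continuous fun t : ℝ => C * √t := by fun_prop
    simpa using (h.tendsto 0).mono_left nhdsWithin_le_nhds
  refine squeeze_zero_norm' ?_ hlim
  filter_upwards [self_mem_nhdsWithin] with t (ht : 0 < t)
  have hs : 0 < √t := Real.sqrt_pos.mpr ht
  calc ‖(√t)⁻¹ • f t‖ ≤ (√t)⁻¹ * (C * |t|) := by
        rw [norm_smul, Real.norm_of_nonneg (inv_nonneg.mpr hs.le)]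
        gcongr
        exact hf t
    _ = C * √t := by
        nth_rewrite 2 [← Real.mul_self_sqrt ht.le]
        rw [abs_of_pos (mul_pos hs hs)]
        field_simp

lemma tendsto_controlCLM_inv_smul_freeCLM_inr (φ : C(Torus d, ℝ)) (g : H1 d) :
    Tendsto (fun t : ℝ => controlCLM φ (t⁻¹ • freeCLM t ((0 : H1 d), toL2 g))) (𝓝[>] 0)
      (𝓝 (controlCLM φ (g, 0))) := by
  have hlim : Tendsto (fun t : ℝ => ‖φ‖ * (|t| * ‖g‖)) (𝓝[>] 0) (𝓝 0) := by
    have h : Continuous fun t : ℝ => ‖φ‖ * (|t| * ‖g‖) := by fun_prop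
    simpa using (h.tendsto 0).mono_left nhdsWithin_le_nhds
  refine tendsto_iff_norm_sub_tendsto_zero.mpr
    (squeeze_zero' (Eventually.of_forall fun _ => norm_nonneg _) ?_ hlim)
  filter_upwards [self_mem_nhdsWithin] with t (ht : 0 < t)
  rw [← map_sub]
  refine (norm_controlCLM_apply_le φ _).trans ?_
  gcongr
  exact norm_inv_smul_freeCLM_inr_fst_sub_le ht.ne' g

-- With `g = φ w` and the impulses `± s φ`, `s = 1 / √δ`, the terms of order `s` cancel, and what
-- remains of order `s² = 1 / δ` is the multiplication by `φ` of `δ g`, the first component of the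
-- free evolution of `(0, g)`.
lemma tendsto_conjugated_freeCLM {φ : C(Torus d, ℝ)} (hφ : PreservesH1 φ) (W : State d) :
    Tendsto (fun δ : ℝ => freeCLM δ (W + controlCLM ((√δ)⁻¹ • φ) W) +
        controlCLM (-(√δ)⁻¹ • φ) (freeCLM δ (W + controlCLM ((√δ)⁻¹ • φ) W)))
      (𝓝[>] 0) (𝓝 (W + controlCLM (-(φ * φ)) W)) := by
  obtain ⟨g, hg⟩ : ∃ g : H1 d, toL2 g = mulL2 φ (toL2 W.1) := ⟨⟨_, hφ W.1⟩, rfl⟩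
  have hW : controlCLM φ W = (0, toL2 g) := by rw [controlCLM_apply, hg]
  have hφφ : controlCLM (-(φ * φ)) W = -controlCLM φ (g, 0) := by
    rw [← neg_one_smul ℝ (φ * φ), controlCLM_smul, _root_.smul_apply, neg_one_smul,
      controlCLM_apply, controlCLM_apply, ← mulL2_mulL2, hg]
  have hfree : Tendsto (fun δ => freeCLM δ W) (𝓝[>] 0) (𝓝 W) := by
    simpa only [freeCLM_zero] using
      ((continuous_freeCLM_apply W).tendsto 0).mono_left nhdsWithin_le_nhds
  have hprofile : Tendsto (fun δ : ℝ => (√δ)⁻¹ • controlCLM φ (freeCLM δ W - W)) (𝓝[>] 0) (𝓝 0) :=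
    tendsto_inv_sqrt_smul (C := ‖φ‖ * (2 * ‖W‖)) fun t =>
      (norm_controlCLM_apply_le φ _).trans (by
        rw [mul_assoc]
        gcongr
        exact norm_toL2_freeCLM_sub_fst_le t W)
  have himpulse : Tendsto (fun δ : ℝ => (√δ)⁻¹ • (freeCLM δ ((0 : H1 d), toL2 g) - (0, toL2 g)))
      (𝓝[>] 0) (𝓝 0) :=
    tendsto_inv_sqrt_smul fun t => (norm_freeCLM_inr_sub_le t g).trans_eq (mul_comm _ _)
  have hlim := ((hfree.add himpulse).sub hprofile).sub (tendsto_controlCLM_inv_smul_freeCLM_inr φ g)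
  rw [hφφ, ← sub_eq_add_neg]
  simp only [add_zero, sub_zero] at hlim
  refine hlim.congr' ?_
  filter_upwards [self_mem_nhdsWithin] with δ (hδ : 0 < δ)
  have hs : (√δ)⁻¹ * (√δ)⁻¹ = δ⁻¹ := by rw [← mul_inv, Real.mul_self_sqrt hδ.le]
  simp only [controlCLM_smul, _root_.smul_apply, map_add, map_sub, map_smul, hW, ← hs]
  module

lemma impulsive_neg_mul_self {φ : C(Torus d, ℝ)} (hφ : ∀ s : ℝ, Impulsive (s • φ))
    (hp : PreservesH1 φ) : Impulsive (-(φ * φ)) := fun W η hη => by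
  have hU := isStronglyContinuousGroup_freeCLM (d := d)
  have hη3 : 0 < η / 3 := by positivity
  refine SteersTo.of_tendsto (tendsto_conjugated_freeCLM hp W) ?_
  filter_upwards [Ioo_mem_nhdsGT hη3] with δ hδ
  have h := ((hφ (√δ)⁻¹ W _ hη3).trans hU (steersTo_free hU waveControl_zero hδ.1 hδ.2 _)).trans hU
    (hφ (-(√δ)⁻¹) _ _ hη3)
  rwa [add_thirds] at h

end Conjugation

/-! ### Impulses along trigonometric polynomials -/

/-- The real trigonometric function `Re (b e^{i m · x})`; unlike `modeFun` it carries no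
normalising factor, which makes products of such functions exact. -/
def trigMode (b : ℂ) (m : Fin d → ℤ) : C(Torus d, ℝ) where
  toFun x := (b * character m x).re
  continuous_toFun := by fun_prop

lemma trigMode_apply (b : ℂ) (m : Fin d → ℤ) (x : Torus d) :
    trigMode b m x = (b * character m x).re := rfl

lemma smul_trigMode (s : ℝ) (b : ℂ) (m : Fin d → ℤ) : s • trigMode b m = trigMode (s * b) m := by
  ext x
  simp [trigMode_apply, mul_assoc]

lemma trigMode_neg (b : ℂ) (m : Fin d → ℤ) : trigMode b (-m) = trigMode (conj b) m := by
  ext x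
  rw [trigMode_apply, trigMode_apply, character_neg, ← Complex.conj_re, map_mul,
    Complex.conj_conj]

lemma modeFun_eq_trigMode (a : ℂ) (k : Fin d → ℤ) :
    modeFun a k = trigMode (a * modeScale d) k := by
  ext x
  change (a * eigenfunction k x).re = _
  rw [trigMode_apply, eigenfunction_apply, mul_assoc]

lemma coeff_mulL2_trigMode (b : ℂ) (m : Fin d → ℤ) (f : L2 d) (k : Fin d → ℤ) :
    coeff (mulL2 (trigMode b m) f) k =
      b / 2 * coeff f (k - m) + conj b / 2 * coeff f (k + m) := by
  rw [coeff, coeff, coeff, ← integral_const_mul, ← integral_const_mul,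
    ← integral_add ((integrable_coeff f _).const_mul _) ((integrable_coeff f _).const_mul _)]
  refine integral_congr_ae ?_
  filter_upwards [coeFn_mulL2 (trigMode b m) f] with x hx
  rw [hx, trigMode_apply, Complex.ofReal_mul, Complex.re_eq_add_conj]
  simp only [eigenfunction_apply, sub_eq_add_neg, character_add, character_neg, map_mul,
    Complex.conj_ofReal, Complex.conj_conj]
  ring

lemma eigenvalue_add_le (k m : Fin d → ℤ) :
    eigenvalue (k + m) ≤ 2 * eigenvalue k + 2 * eigenvalue m := by
  simp only [eigenvalue, Finset.mul_sum, ← Finset.sum_add_distrib]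
  refine Finset.sum_le_sum fun i _ => ?_
  rw [Pi.add_apply, Int.cast_add]
  exact add_sq_le.trans_eq (mul_add _ _ _)

lemma summable_eigenvalue_mul_coeff_add (f : H1 d) (m : Fin d → ℤ) :
    Summable fun k => eigenvalue k * ‖coeff (toL2 f) (k + m)‖ ^ 2 := by
  have hH1 : Summable fun k : Fin d → ℤ => eigenvalue k * ‖coeff (toL2 f) k‖ ^ 2 :=
    (mem_h1Submodule_iff (toL2 f)).mp f.2
  have hshift := (Equiv.addRight m).summable_iff.mpr ((hH1.mul_left 2).add
    ((hasSum_norm_coeff_sq (toL2 f)).summable.mul_left (2 * eigenvalue m)))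
  refine hshift.of_nonneg_of_le (fun k => mul_nonneg (eigenvalue_nonneg k) (sq_nonneg _))
    fun k => ?_
  have hk := eigenvalue_add_le (k + m) (-m)
  rw [add_neg_cancel_right, eigenvalue_neg] at hk
  refine (mul_le_mul_of_nonneg_right hk (sq_nonneg _)).trans_eq ?_
  simp only [Function.comp_apply, Equiv.coe_addRight]
  ring

lemma preservesH1_trigMode (b : ℂ) (m : Fin d → ℤ) : PreservesH1 (trigMode b m) := fun f => by
  rw [mem_h1Submodule_iff]
  refine (((summable_eigenvalue_mul_coeff_add f (-m)).mul_left (2 * ‖b / 2‖ ^ 2)).add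
    ((summable_eigenvalue_mul_coeff_add f m).mul_left (2 * ‖conj b / 2‖ ^ 2))).of_nonneg_of_le
    (fun k => mul_nonneg (eigenvalue_nonneg k) (sq_nonneg _)) fun k => ?_
  rw [coeff_mulL2_trigMode, sub_eq_add_neg]
  refine (mul_le_mul_of_nonneg_left (norm_add_sq_le_two_mul _ _)
    (eigenvalue_nonneg k)).trans_eq ?_
  rw [norm_mul, norm_mul]
  ring

lemma fourier_one_coe (r : ℝ) :
    (fourier 1 (r : AddCircle (2 * Real.pi)) : ℂ) = Complex.exp (r * Complex.I) := by
  have hpi : (Real.pi : ℂ) ≠ 0 := Complex.ofReal_ne_zero.mpr Real.pi_ne_zero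
  rw [fourier_coe_apply]
  congr 1
  push_cast
  field_simp

lemma fourier_one_re (y : AddCircle (2 * Real.pi)) :
    (fourier 1 y : ℂ).re = Real.Angle.cos y := by
  induction y using QuotientAddGroup.induction_on with
  | H r =>
    exact (congrArg Complex.re (fourier_one_coe r)).trans (Complex.exp_ofReal_mul_I_re r)

lemma fourier_one_im (y : AddCircle (2 * Real.pi)) :
    (fourier 1 y : ℂ).im = Real.Angle.sin y := by
  induction y using QuotientAddGroup.induction_on with
  | H r =>
    exact (congrArg Complex.im (fourier_one_coe r)).trans (Complex.exp_ofReal_mul_I_im r)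

lemma controlMode_cos (i : Fin d) :
    controlMode (Fin.succ (⟨2 * i, by omega⟩ : Fin (2 * d))) = trigMode 1 (Pi.single i 1) := by
  ext x
  have hi : (⟨2 * (i : ℕ) / 2, by omega⟩ : Fin d) = i := Fin.ext (by simp)
  rw [trigMode_apply, character_single, one_mul, fourier_one_re]
  simp only [controlMode, Fin.cases_succ, Nat.mul_mod_right, if_true, ContinuousMap.coe_mk, hi]

lemma controlMode_sin (i : Fin d) :
    controlMode (Fin.succ (⟨2 * i + 1, by omega⟩ : Fin (2 * d))) =
      trigMode (-Complex.I) (Pi.single i 1) := by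
  ext x
  have hi : (⟨(2 * (i : ℕ) + 1) / 2, by omega⟩ : Fin d) = i := Fin.ext (by simp; omega)
  have hmod : ¬ (2 * (i : ℕ) + 1) % 2 = 0 := by omega
  rw [trigMode_apply, character_single, neg_mul, Complex.neg_re, Complex.I_mul_re, neg_neg,
    fourier_one_im]
  simp only [controlMode, Fin.cases_succ, hmod, if_false, ContinuousMap.coe_mk, hi]

lemma potential_single (j : Fin (2 * d + 1)) (s : ℝ) :
    potential (Pi.single j s) = s • controlMode j := by
  rw [potential, Fintype.sum_eq_single j fun i hi => by rw [Pi.single_eq_of_ne hi, zero_smul],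
    Pi.single_eq_same]

lemma impulsive_smul_controlMode (s : ℝ) (j : Fin (2 * d + 1)) :
    Impulsive (s • controlMode j) := by
  rw [← potential_single]
  exact impulsive_potential _

lemma impulsive_const (s : ℝ) : Impulsive (s • (1 : C(Torus d, ℝ))) :=
  impulsive_smul_controlMode s 0

lemma impulsive_trigMode_zero (b : ℂ) : Impulsive (trigMode b (0 : Fin d → ℤ)) := by
  convert impulsive_const (d := d) b.re using 1
  ext x
  simp [trigMode_apply, character_zero]

lemma impulsive_trigMode_single (b : ℂ) (i : Fin d) : Impulsive (trigMode b (Pi.single i 1)) := by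
  have hcos := impulsive_smul_controlMode b.re (Fin.succ (⟨2 * i, by omega⟩ : Fin (2 * d)))
  have hsin := impulsive_smul_controlMode (-b.im)
    (Fin.succ (⟨2 * i + 1, by omega⟩ : Fin (2 * d)))
  rw [controlMode_cos] at hcos
  rw [controlMode_sin] at hsin
  convert hcos.add hsin using 1
  ext x
  simp [trigMode_apply]
  ring

lemma norm_character (k : Fin d → ℤ) (x : Torus d) : ‖character k x‖ = 1 := by
  rw [character_apply, norm_prod]
  exact Finset.prod_eq_one fun i _ => Circle.norm_coe _

-- With `z = e^{i k · x}` and `w = b e^{i m · x}`, both squares together are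
-- `(Re z + Re w)² + (Im z - Im w)² = |z + conj w|² = 1 + |b|² + 2 Re (z w)`.
lemma neg_two_smul_trigMode_add (b : ℂ) (k m : Fin d → ℤ) :
    (-2 : ℝ) • trigMode b (k + m) =
      -((trigMode 1 k + trigMode b m) * (trigMode 1 k + trigMode b m)) +
      -((trigMode (-Complex.I) k + trigMode (Complex.I * b) m) *
        (trigMode (-Complex.I) k + trigMode (Complex.I * b) m)) +
      (1 + ‖b‖ ^ 2) • (1 : C(Torus d, ℝ)) := by
  ext x
  simp only [ContinuousMap.smul_apply, ContinuousMap.add_apply, ContinuousMap.neg_apply,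
    ContinuousMap.mul_apply, ContinuousMap.one_apply, trigMode_apply, character_add, smul_eq_mul]
  have hk := congrArg (· ^ 2) (norm_character k x)
  have hm := congrArg (· ^ 2) (norm_character m x)
  simp only [Complex.sq_norm, Complex.normSq_apply, one_pow] at hk hm
  rw [Complex.sq_norm, Complex.normSq_apply]
  simp only [Complex.mul_re, Complex.mul_im, Complex.neg_re, Complex.neg_im, Complex.I_re,
    Complex.I_im, Complex.one_re, Complex.one_im]
  linear_combination hk + (b.re * b.re + b.im * b.im) * hm

lemma impulsive_trigMode_add {k m : Fin d → ℤ} (hk : ∀ b, Impulsive (trigMode b k))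
    (hm : ∀ b, Impulsive (trigMode b m)) (b : ℂ) : Impulsive (trigMode b (k + m)) := by
  have hsq : ∀ a c : ℂ, Impulsive (-((trigMode a k + trigMode c m) *
      (trigMode a k + trigMode c m))) := fun a c =>
    impulsive_neg_mul_self (fun s => by
      rw [smul_add, smul_trigMode, smul_trigMode]
      exact (hk _).add (hm _)) ((preservesH1_trigMode a k).add (preservesH1_trigMode c m))
  have htwo : Impulsive ((-2 : ℝ) • trigMode (-b / 2) (k + m)) := by
    rw [neg_two_smul_trigMode_add]
    exact ((hsq _ _).add (hsq _ _)).add (impulsive_const _)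
  rw [smul_trigMode] at htwo
  convert htwo using 2
  push_cast
  ring

/-- The frequencies all of whose trigonometric functions are impulsive; being a group containing
the basis vectors, it is all of `ℤ^d`. -/
def impulsiveFrequencies (d : ℕ) : AddSubgroup (Fin d → ℤ) where
  carrier := {m | ∀ b, Impulsive (trigMode b m)}
  zero_mem' := impulsive_trigMode_zero
  add_mem' hk hm := impulsive_trigMode_add hk hm
  neg_mem' hm b := by
    rw [trigMode_neg]
    exact hm _

lemma impulsive_trigMode (b : ℂ) (m : Fin d → ℤ) : Impulsive (trigMode b m) := by
  suffices m ∈ impulsiveFrequencies d from this b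
  rw [← Finset.univ_sum_single m]
  refine AddSubgroup.sum_mem _ fun i _ => ?_
  have hbasis : (Pi.single i 1 : Fin d → ℤ) ∈ impulsiveFrequencies d := fun b =>
    impulsive_trigMode_single b i
  have hsingle : (Pi.single i (m i) : Fin d → ℤ) = m i • Pi.single i 1 := by
    rw [← Pi.single_smul, smul_eq_mul, mul_one]
  rw [hsingle]
  exact AddSubgroup.zsmul_mem _ hbasis _

/-- The real trigonometric polynomials on the torus, the potentials in whose direction the velocity
will be shown to be controllable. -/
def trigPolynomials (d : ℕ) : Submodule ℝ C(Torus d, ℝ) :=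
  Submodule.span ℝ (range fun p : ℂ × (Fin d → ℤ) => trigMode p.1 p.2)

lemma impulsive_of_mem_trigPolynomials {φ : C(Torus d, ℝ)} (hφ : φ ∈ trigPolynomials d) :
    Impulsive φ := by
  suffices ∀ s : ℝ, Impulsive (s • φ) by simpa only [one_smul] using this 1
  induction hφ using Submodule.span_induction with
  | mem _ hmode =>
    obtain ⟨p, rfl⟩ := hmode
    intro s
    rw [smul_trigMode]
    exact impulsive_trigMode _ _
  | zero =>
    intro s
    rw [smul_zero, ← zero_smul ℝ (1 : C(Torus d, ℝ))]
    exact impulsive_const 0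
  | add φ ψ _ _ hφ hψ =>
    intro s
    rw [smul_add]
    exact (hφ s).add (hψ s)
  | smul a φ _ hφ =>
    intro s
    rw [smul_smul]
    exact hφ _

/-! ### Zeros of trigonometric polynomials -/

lemma exists_injOn_eval {R : Type*} [CommRing R] [IsDomain R] [Infinite R]
    (S : Finset (Polynomial R)) : ∃ r : R, InjOn (Polynomial.eval r) (S : Set (Polynomial R)) := by
  classical
  have hprod : ∏ pq ∈ S.offDiag, (pq.1 - pq.2) ≠ 0 :=
    Finset.prod_ne_zero_iff.mpr fun pq hpq => sub_ne_zero.mpr (Finset.mem_offDiag.mp hpq).2.2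
  obtain ⟨r, hr⟩ : ∃ r, Polynomial.eval r (∏ pq ∈ S.offDiag, (pq.1 - pq.2)) ≠ 0 := by
    by_contra! h
    exact hprod (Polynomial.funext fun r => by rw [h, Polynomial.eval_zero])
  rw [Polynomial.eval_prod, Finset.prod_ne_zero_iff] at hr
  refine ⟨r, fun p hp q hq heq => ?_⟩
  by_contra hne
  refine hr (p, q) (Finset.mem_offDiag.mpr ⟨hp, hq, hne⟩) ?_
  rw [Polynomial.eval_sub, heq, sub_self]

-- The direction is `(1, N, …, N ^ (d - 1))`, along which `k` becomes the value at `N` of the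
-- polynomial with coefficients `k`.
lemma exists_injOn_sum_mul (S : Finset (Fin d → ℤ)) :
    ∃ θ : Fin d → ℤ, InjOn (fun k : Fin d → ℤ => ∑ i, k i * θ i) S := by
  classical
  obtain ⟨N, hN⟩ := exists_injOn_eval (S.image (Polynomial.ofFn d))
  refine ⟨fun i => N ^ (i : ℕ), fun k hk l hl h => Polynomial.injective_ofFn d ?_⟩
  refine hN (Finset.mem_image_of_mem _ hk) (Finset.mem_image_of_mem _ hl) ?_
  simpa only [Polynomial.ofFn_eq_sum_monomial, Polynomial.eval_finsetSum,
    Polynomial.eval_monomial] using h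

lemma finite_zeros_laurentPolynomial {K : Type*} [Field K] {f : LaurentPolynomial K}
    (hf : f ≠ 0) : {u : Kˣ | LaurentPolynomial.eval₂ (RingHom.id K) u f = 0}.Finite := by
  obtain ⟨n, p, hp⟩ := f.exists_T_pow
  have hp0 : p ≠ 0 := by
    rintro rfl
    rw [map_zero, eq_comm, (LaurentPolynomial.isUnit_T n).mul_left_eq_zero] at hp
    exact hf hp
  refine ((Polynomial.finite_setOfPred_isRoot hp0).preimage Units.val_injective.injOn).subset
    fun u (hu : LaurentPolynomial.eval₂ (RingHom.id K) u f = 0) => ?_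
  have h := LaurentPolynomial.eval₂_toLaurent (RingHom.id K) u p
  rwa [hp, map_mul, hu, zero_mul, eq_comm] at h

lemma finite_zeros_sum_fourier {ι : Type*} {S : Finset ι} {n : ι → ℤ} (hn : InjOn n S) {b : ι → ℂ}
    {j : ι} (hj : j ∈ S) (hb : b j ≠ 0) :
    {s : AddCircle (2 * Real.pi) | ∑ k ∈ S, b k * (fourier (n k) s : ℂ) = 0}.Finite := by
  classical
  let f : LaurentPolynomial ℂ := ∑ k ∈ S, LaurentPolynomial.C (b k) * LaurentPolynomial.T (n k)
  have hcoeff : f.coeff (n j) = b j := by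
    simp only [f, ← LaurentPolynomial.single_eq_C_mul_T, AddMonoidAlgebra.coeff_sum,
      AddMonoidAlgebra.coeff_single, Finsupp.finsetSum_apply, Finsupp.single_apply]
    rw [Finset.sum_eq_single j (fun k hk hkj => if_neg fun h => hkj (hn hk hj h))
      (fun h => absurd hj h), if_pos rfl]
  have hf : f ≠ 0 := fun h => hb (by rw [← hcoeff, h]; rfl)
  have hinj : Function.Injective fun s : AddCircle (2 * Real.pi) => Circle.toUnits s.toCircle :=
    fun s t h => AddCircle.injective_toCircle Real.two_pi_pos.ne'
      (Circle.ext (congrArg Units.val h))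
  refine ((finite_zeros_laurentPolynomial hf).preimage hinj.injOn).subset
    fun s (hs : ∑ k ∈ S, b k * (fourier (n k) s : ℂ) = 0) => ?_
  have hfourier : ∀ m : ℤ,
      (fourier m s : ℂ) = ((Circle.toUnits s.toCircle ^ m : ℂˣ) : ℂ) := fun m => by
    rw [fourier_apply, AddCircle.toCircle_zsmul, Circle.coe_zpow, Units.val_zpow_eq_zpow_val]
    rfl
  simpa only [mem_preimage, mem_ofPred_eq, f, map_sum, LaurentPolynomial.eval₂_C_mul_T,
    RingHom.id_apply, ← hfourier] using hs

lemma character_add_smul (k θ : Fin d → ℤ) (x : Torus d) (s : AddCircle (2 * Real.pi)) :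
    character k (x + fun i => θ i • s) =
      character k x * (fourier (∑ i, k i * θ i) s : ℂ) := by
  have hsum : ∀ I : Finset (Fin d),
      (fourier (∑ i ∈ I, k i * θ i) s : ℂ) = ∏ i ∈ I, (fourier (k i) (θ i • s) : ℂ) := fun I => by
    induction I using Finset.induction with
    | empty => simp
    | insert i I hi ih =>
      rw [Finset.sum_insert hi, Finset.prod_insert hi, fourier_add, ih]
      simp only [fourier_apply, smul_smul]
  rw [hsum, character_apply, character_apply, ← Finset.prod_mul_distrib]
  refine Finset.prod_congr rfl fun i _ => ?_
  simp [fourier_apply, smul_add, AddCircle.toCircle_add]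

instance nullSingletonClass_addCircle :
    NullSingletonClass (volume : Measure (AddCircle (2 * Real.pi))) where
  measure_singleton x := by
    rw [← Metric.closedBall_zero, AddCircle.volume_closedBall, mul_zero,
      min_eq_right Real.two_pi_pos.le, ENNReal.ofReal_zero]

-- By Fubini it suffices to look at the restrictions to the lines in a direction `θ` along which
-- the frequencies stay distinct; there the sum is a polynomial in `e^{is}`.
lemma ae_sum_character_ne_zero {S : Finset (Fin d → ℤ)} {a : (Fin d → ℤ) → ℂ} {j : Fin d → ℤ}
    (hj : j ∈ S) (ha : a j ≠ 0) : ∀ᵐ x : Torus d, ∑ k ∈ S, a k * character k x ≠ 0 := by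
  obtain ⟨θ, hθ⟩ := exists_injOn_sum_mul S
  have hline : ∀ x : Torus d, ∀ᵐ s : AddCircle (2 * Real.pi),
      ∑ k ∈ S, a k * character k (x + fun i => θ i • s) ≠ 0 := fun x => by
    have hne : a j * character j x ≠ 0 :=
      mul_ne_zero ha (norm_ne_zero_iff.mp (by rw [norm_character]; exact one_ne_zero))
    have hfin := finite_zeros_sum_fourier hθ (b := fun k => a k * character k x) hj hne
    rw [ae_iff]
    simpa only [character_add_smul, not_not, ← mul_assoc] using! hfin.measure_zero volume
  have hcont : Continuous fun p : Torus d × AddCircle (2 * Real.pi) =>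
      ∑ k ∈ S, a k * character k (p.1 + fun i => θ i • p.2) := by fun_prop
  have hae := (Measure.ae_ae_comm (μ := (volume : Measure (Torus d)))
    (ν := (volume : Measure (AddCircle (2 * Real.pi))))
    (isOpen_ne_fun hcont continuous_const).measurableSet).mp (Filter.Eventually.of_forall hline)
  obtain ⟨s, hs⟩ := hae.exists
  exact (eventually_add_right_iff (volume : Measure (Torus d)) (fun i => θ i • s)
    (p := fun x => ∑ k ∈ S, a k * character k x ≠ 0)).mp hs

/-! ### Functions with finitely many modes -/

lemma hasFinitelyManyModes_zero : HasFinitelyManyModes (0 : L2 d) := by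
  simp [HasFinitelyManyModes, coeff_zero]

lemma HasFinitelyManyModes.add {f g : L2 d} (hf : HasFinitelyManyModes f)
    (hg : HasFinitelyManyModes g) : HasFinitelyManyModes (f + g) := by
  refine (hf.union hg).subset fun k hk => ?_
  by_contra h
  simp only [mem_union, mem_ofPred_eq, not_or, not_not] at h
  exact hk (by rw [coeff_add, h.1, h.2, add_zero])

lemma hasFinitelyManyModes_modeL2 (a : ℂ) (k : Fin d → ℤ) :
    HasFinitelyManyModes (modeL2 a k) := by
  refine (toFinite {k, -k}).subset fun j hj => ?_
  by_contra h
  simp only [mem_insert_iff, mem_singleton_iff, not_or] at h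
  exact hj (coeff_modeL2 a k j h.1 h.2)

lemma hasFinitelyManyModes_sum_modeH1 (S : Finset (Fin d → ℤ)) (c : (Fin d → ℤ) → ℂ) :
    HasFinitelyManyModes (toL2 (∑ k ∈ S, modeH1 (c k) k)) := by
  rw [map_sum]
  exact Finset.sum_induction _ HasFinitelyManyModes (fun _ _ => HasFinitelyManyModes.add)
    hasFinitelyManyModes_zero fun k _ => hasFinitelyManyModes_modeL2 (c k) k

lemma modeH1_one_zero_ne_zero : (modeH1 1 0 : H1 d) ≠ 0 := fun h => by
  have hcoeff : coeff (toL2 (modeH1 1 0 : H1 d)) 0 = 1 := by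
    rw [toL2_modeH1, coeff_modeL2_eq]
    norm_num
  rw [h, map_zero, coeff_zero] at hcoeff
  exact zero_ne_one hcoeff

lemma exists_hasFinitelyManyModes_near (w : H1 d) {ε : ℝ} (hε : 0 < ε) :
    ∃ w' : H1 d, w' ≠ 0 ∧ HasFinitelyManyModes (toL2 w') ∧ ‖w' - w‖ < ε := by
  have : Nontrivial (H1 d) := ⟨_, _, modeH1_one_zero_ne_zero⟩
  have := Module.punctured_nhds_neBot ℝ (H1 d) 0
  obtain ⟨v, hv⟩ : (Metric.ball w ε ∩ {0}ᶜ).Nonempty :=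
    (dense_compl_singleton 0).inter_open_nonempty _ Metric.isOpen_ball ⟨w, Metric.mem_ball_self hε⟩
  have hopen : IsOpen (Metric.ball w ε ∩ {0}ᶜ) := Metric.isOpen_ball.inter isOpen_compl_singleton
  obtain ⟨S, hball, hne⟩ := ((hasSum_modeH1_coeff v).eventually (hopen.mem_nhds hv)).exists
  exact ⟨_, hne, hasFinitelyManyModes_sum_modeH1 S _, mem_ball_iff_norm.mp hball⟩

lemma HasFinitelyManyModes.ae_eq_sum {f : L2 d} (hf : HasFinitelyManyModes f) :
    ∀ᵐ x, (f x : ℂ) = ∑ k ∈ Set.Finite.toFinset hf, coeff f k * eigenfunction k x := by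
  have hseries := (eigenBasis d).hasSum_repr (complexify d f)
  simp only [eigenBasis_repr_complexify, eigenBasis_apply] at hseries
  have hsum : complexify d f = ContinuousMap.toLp (E := ℂ) 2 volume ℂ
      (∑ k ∈ Set.Finite.toFinset hf, coeff f k • eigenfunction k) := by
    rw [map_sum]
    simp only [map_smul]
    refine hseries.unique (hasSum_sum_of_ne_finset_zero fun k hk => ?_)
    have hk0 : coeff f k = 0 := not_not.mp (mt (Set.Finite.mem_toFinset hf).mpr hk)
    rw [hk0, zero_smul]
  filter_upwards [coeFn_complexify f, ContinuousMap.coeFn_toLp (𝕜 := ℂ) (p := 2) volume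
    (∑ k ∈ Set.Finite.toFinset hf, coeff f k • eigenfunction k)] with x hx hy
  rw [← hx, hsum, hy]
  simp

lemma HasFinitelyManyModes.exists_continuousMap {f : L2 d} (hf : HasFinitelyManyModes f) :
    ∃ F : C(Torus d, ℝ), ∀ᵐ x, f x = F x := by
  refine ⟨⟨fun x => (∑ k ∈ Set.Finite.toFinset hf, coeff f k * eigenfunction k x).re,
    by fun_prop⟩, ?_⟩
  filter_upwards [hf.ae_eq_sum] with x hx
  simp only [ContinuousMap.coe_mk, ← hx, Complex.ofReal_re]

lemma exists_coeff_ne_zero {f : L2 d} (hf : f ≠ 0) : ∃ k, coeff f k ≠ 0 := by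
  by_contra! h
  exact hf (coeff_ext fun k => by rw [h, coeff_zero])

lemma HasFinitelyManyModes.ae_ne_zero {f : L2 d} (hf : HasFinitelyManyModes f) (hne : f ≠ 0) :
    ∀ᵐ x, f x ≠ 0 := by
  obtain ⟨j, hj⟩ := exists_coeff_ne_zero hne
  have hscale : (modeScale d : ℂ) ≠ 0 := Complex.ofReal_ne_zero.mpr (modeScale_pos d).ne'
  filter_upwards [hf.ae_eq_sum, ae_sum_character_ne_zero (a := fun k => coeff f k * modeScale d)
    ((Set.Finite.mem_toFinset hf).mpr hj) (mul_ne_zero hj hscale)] with x hx hsum hfx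
  refine hsum ?_
  rw [hfx, Complex.ofReal_zero] at hx
  simpa only [eigenfunction_apply, mul_assoc] using hx.symm

/-! ### Density of the products with trigonometric polynomials -/

lemma inner_mulL2 (V : C(Torus d, ℝ)) (f g : L2 d) :
    inner ℝ (mulL2 V f) g = inner ℝ f (mulL2 V g) := by
  rw [L2.inner_def, L2.inner_def]
  refine integral_congr_ae ?_
  filter_upwards [coeFn_mulL2 V f, coeFn_mulL2 V g] with x hf hg
  simp only [hf, hg, RCLike.inner_apply, conj_trivial]
  ring

lemma eq_zero_of_mulL2_eq_zero {V : C(Torus d, ℝ)} (hV : ∀ᵐ x, V x ≠ 0) {f : L2 d}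
    (h : mulL2 V f = 0) : f = 0 := by
  refine Lp.ext ?_
  filter_upwards [hV, coeFn_mulL2 V f, Lp.coeFn_zero ℝ 2 (volume : Measure (Torus d))]
    with x hVx hmul hzero
  rw [h, hzero, Pi.zero_apply] at hmul
  rw [hzero, Pi.zero_apply]
  exact (mul_eq_zero.mp hmul.symm).resolve_left hVx

lemma mulL2_modeFun {f : L2 d} {F : C(Torus d, ℝ)} (hF : ∀ᵐ x, f x = F x) (a : ℂ)
    (k : Fin d → ℤ) : mulL2 (modeFun a k) f = mulL2 F (modeL2 a k) := by
  refine Lp.ext ?_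
  filter_upwards [coeFn_mulL2 (modeFun a k) f, coeFn_mulL2 F (modeL2 a k), coeFn_modeL2 a k, hF]
    with x hmode hmul hL2 hfx
  rw [hmode, hmul, hL2, hfx]
  exact mul_comm _ _

lemma eq_zero_of_inner_modeL2_eq_zero {f : L2 d} (h : ∀ a k, inner ℝ (modeL2 a k) f = 0) :
    f = 0 :=
  coeff_ext fun k => by simp [coeff_eq_inner, h]

lemma HasFinitelyManyModes.exists_mulL2_near {f : L2 d} (hf : HasFinitelyManyModes f)
    (hne : f ≠ 0) (v : L2 d) {ε : ℝ} (hε : 0 < ε) :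
    ∃ φ ∈ trigPolynomials d, ‖mulL2 φ f - v‖ < ε := by
  let L : C(Torus d, ℝ) →ₗ[ℝ] L2 d :=
    { toFun := fun φ => mulL2 φ f
      map_add' := fun φ ψ => add_mulL2 φ ψ f
      map_smul' := fun c φ => smul_mulL2 c φ f }
  obtain ⟨F, hF⟩ := hf.exists_continuousMap
  have hF0 : ∀ᵐ x, F x ≠ 0 := by
    filter_upwards [hF, hf.ae_ne_zero hne] with x hx hfx
    rwa [← hx]
  have hdense : ((trigPolynomials d).map L).topologicalClosure = ⊤ := by
    rw [Submodule.topologicalClosure_eq_top_iff, Submodule.eq_bot_iff]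
    refine fun g hg => eq_zero_of_mulL2_eq_zero hF0 (eq_zero_of_inner_modeL2_eq_zero fun a k => ?_)
    have hmem : mulL2 (modeFun a k) f ∈ (trigPolynomials d).map L := by
      refine ⟨modeFun a k, ?_, rfl⟩
      rw [modeFun_eq_trigMode]
      exact Submodule.subset_span ⟨(a * modeScale d, k), rfl⟩
    rw [← inner_mulL2, ← mulL2_modeFun hF]
    exact (Submodule.mem_orthogonal _ _).mp hg _ hmem
  have hv : v ∈ ((trigPolynomials d).map L).topologicalClosure := hdense ▸ Submodule.mem_top
  obtain ⟨_, ⟨φ, hφ, rfl⟩, hlt⟩ := Metric.mem_closure_iff.mp hv ε hε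
  exact ⟨φ, hφ, by rwa [dist_comm, dist_eq_norm] at hlt⟩

/-! ### Small-time approximate controllability -/

section SmallTime

open Filter Topology

lemma steersTo_velocity {w : H1 d} (h0 : w ≠ 0) (hw : HasFinitelyManyModes (toL2 w)) (v v' : L2 d)
    {η : ℝ} (hη : 0 < η) : SteersTo freeCLM waveControl η (w, v) (w, v') := by
  refine SteersTo.of_forall_near fun ε hε => ?_
  obtain ⟨φ, hφ, hnear⟩ := hw.exists_mulL2_near
    (fun h => h0 (toL2_injective (by rw [h, map_zero]))) (v' - v) hε
  refine ⟨_, impulsive_of_mem_trigPolynomials hφ (w, v) η hη, ?_⟩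
  have hdiff : ((w, v) : State d) + controlCLM φ (w, v) - (w, v') =
      ((0 : H1 d), mulL2 φ (toL2 w) - (v' - v)) := by
    rw [controlCLM_apply, Prod.mk_add_mk, Prod.mk_sub_mk, add_zero, sub_self]
    exact congrArg _ (by abel)
  rwa [hdiff, Prod.norm_mk, norm_zero, max_eq_right (norm_nonneg _)]

lemma eventually_sineMultiplier_ne_zero (lam : ℝ) :
    ∀ᶠ t in 𝓝[>] (0 : ℝ), sineMultiplier lam t ≠ 0 := by
  have hcont : Continuous fun t : ℝ => Real.sinc (Real.sqrt lam * t) := by fun_prop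
  have hsinc : ∀ᶠ t in 𝓝 (0 : ℝ), Real.sinc (Real.sqrt lam * t) ≠ 0 :=
    hcont.continuousAt.eventually_ne (by simp)
  filter_upwards [hsinc.filter_mono nhdsWithin_le_nhds, self_mem_nhdsWithin] with t ht hpos
  exact mul_ne_zero (ne_of_gt hpos) ht

-- The velocity solves one linear equation per mode, of slope `sineMultiplier (eigenvalue k) δ`.
lemma eventually_exists_velocity {w w' : H1 d} (hw : HasFinitelyManyModes (toL2 w))
    (hw' : HasFinitelyManyModes (toL2 w')) :
    ∀ᶠ δ in 𝓝[>] (0 : ℝ), ∃ v : L2 d, (freeCLM δ (w, v)).1 = w' := by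
  filter_upwards [(eventually_all_finite (hw.union hw')).mpr fun k _ =>
    eventually_sineMultiplier_ne_zero (eigenvalue k)] with δ hδ
  let c : (Fin d → ℤ) → ℂ := fun k =>
    (coeff (toL2 w') k - cosMultiplier (eigenvalue k) δ * coeff (toL2 w) k) /
      sineMultiplier (eigenvalue k) δ
  have hout : ∀ k, k ∉ {k | coeff (toL2 w) k ≠ 0} ∪ {k | coeff (toL2 w') k ≠ 0} →
      coeff (toL2 w) k = 0 ∧ coeff (toL2 w') k = 0 := fun k hk => by
    simpa [not_or] using hk
  have hc : IsHermitianSeq c := fun k => by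
    simp [c, coeff_neg_index, eigenvalue_neg]
  have hs : Summable fun k => ‖c k‖ ^ 2 := by
    refine summable_of_hasFiniteSupport ((hw.union hw').subset fun k hk => ?_)
    by_contra hmem
    obtain ⟨hk0, hk0'⟩ := hout k hmem
    simp [c, hk0, hk0'] at hk
  obtain ⟨v, -, hv⟩ := exists_hasSum_modeL2 hc hs
  refine ⟨v, H1.coeff_ext fun k => ?_⟩
  rw [freeCLM_apply, coeff_freeEvolution_fst, profileCoeff]
  simp only [hv, c]
  by_cases hk : k ∈ {k | coeff (toL2 w) k ≠ 0} ∪ {k | coeff (toL2 w') k ≠ 0}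
  · rw [mul_div_cancel₀ _ (Complex.ofReal_ne_zero.mpr (hδ k hk)), add_sub_cancel]
  · obtain ⟨hk0, hk0'⟩ := hout k hk
    simp [hk0, hk0']

lemma steersTo_of_profile {w : H1 d} (h0 : w ≠ 0) (hw : HasFinitelyManyModes (toL2 w)) (v : L2 d)
    (W : State d) {η : ℝ} (hη : 0 < η) : SteersTo freeCLM waveControl η (w, v) W := by
  have hU := isStronglyContinuousGroup_freeCLM (d := d)
  have hη3 : 0 < η / 3 := by positivity
  refine SteersTo.of_forall_near fun ε hε => ?_
  obtain ⟨w', h0', hw', hnear⟩ := exists_hasFinitelyManyModes_near W.1 hε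
  refine ⟨(w', W.2), ?_, ?_⟩
  · obtain ⟨δ, ⟨u, hu⟩, hδ⟩ := ((eventually_exists_velocity hw hw').and
      (Ioo_mem_nhdsGT hη3)).exists
    have hfree : SteersTo freeCLM waveControl (η / 3) (w, u) (w', (freeCLM δ (w, u)).2) := by
      simpa only [← hu] using steersTo_free hU waveControl_zero hδ.1 hδ.2 (w, u)
    have h := ((steersTo_velocity h0 hw v u hη3).trans hU hfree).trans hU
      (steersTo_velocity h0' hw' _ W.2 hη3)
    rwa [add_thirds] at h
  · have hdiff : ((w', W.2) : State d) - W = (w' - W.1, 0) := Prod.ext rfl (sub_self _)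
    rwa [hdiff, Prod.norm_mk, norm_zero, max_eq_left (norm_nonneg _)]

lemma eventually_profile_of_velocity {v : L2 d} (h0 : v ≠ 0) (hv : HasFinitelyManyModes v) :
    ∀ᶠ δ in 𝓝[>] (0 : ℝ), (freeCLM δ ((0 : H1 d), v)).1 ≠ 0 ∧
      HasFinitelyManyModes (toL2 (freeCLM δ ((0 : H1 d), v)).1) := by
  obtain ⟨k, hk⟩ := exists_coeff_ne_zero h0
  filter_upwards [eventually_sineMultiplier_ne_zero (eigenvalue k)] with δ hδ
  refine ⟨fun h => ?_, hv.subset fun j hj h => hj (by rw [coeff_freeCLM_inr_fst, h, mul_zero])⟩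
  have hcoeff := coeff_freeCLM_inr_fst δ v k
  rw [h, map_zero, coeff_zero] at hcoeff
  exact mul_ne_zero (Complex.ofReal_ne_zero.mpr hδ) hk hcoeff.symm

lemma steersTo_of_velocity {v : L2 d} (h0 : v ≠ 0) (hv : HasFinitelyManyModes v) (W : State d)
    {η : ℝ} (hη : 0 < η) : SteersTo freeCLM waveControl η ((0 : H1 d), v) W := by
  have hU := isStronglyContinuousGroup_freeCLM (d := d)
  obtain ⟨δ, ⟨hne, hfin⟩, hδ⟩ := ((eventually_profile_of_velocity h0 hv).and
    (Ioo_mem_nhdsGT (half_pos hη))).exists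
  have h := (steersTo_free hU waveControl_zero hδ.1 hδ.2 ((0 : H1 d), v)).trans hU
    (steersTo_of_profile hne hfin _ W (half_pos hη))
  rwa [add_halves] at h

lemma stateNorm_le (W : State d) : stateNorm W ≤ 2 * ‖W‖ := by
  rw [stateNorm, Real.sqrt_le_left (by positivity)]
  have hfst := pow_le_pow_left₀ (norm_nonneg _) (norm_fst_le W) 2
  have hsnd := pow_le_pow_left₀ (norm_nonneg _) (norm_snd_le W) 2
  nlinarith [sq_nonneg ‖W‖]

lemma isSolution_iff {T : ℝ} {p : ℝ → Fin (2 * d + 1) → ℝ} {W₀ : State d} {W : ℝ → State d} :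
    IsSolution T p W₀ W ↔ IsMildSolution freeCLM (fun s => waveControl (p s)) T W₀ W := Iff.rfl

end SmallTime

end BilinearWave

end

theorem theorem1 (d : ℕ) (w₀ : H1 d) (v₀ : L2 d) (hne : (w₀, v₀) ≠ ((0, 0) : State d))
    (hinit : (w₀ ≠ 0 ∧ HasFinitelyManyModes (toL2 w₀)) ∨
      (w₀ = 0 ∧ v₀ ≠ 0 ∧ HasFinitelyManyModes v₀))
    (w₁ : H1 d) (v₁ : L2 d) (ε T : ℝ) (hε : 0 < ε) (hT : 0 < T) :
    ∃ p : ℝ → Fin (2 * d + 1) → ℝ, IsPiecewiseConstant T p ∧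
      ∃ W : ℝ → State d, IsSolution T p (w₀, v₀) W ∧
        (∀ W' : ℝ → State d, IsSolution T p (w₀, v₀) W' → Set.EqOn W' W (Set.Icc 0 T)) ∧
        stateNorm (W T - (w₁, v₁)) < ε := by
  have hU := isStronglyContinuousGroup_freeCLM (d := d)
  have hreach : ∀ η > 0, ∀ W, SteersTo freeCLM waveControl η (w₀, v₀) W := fun η hη W => by
    rcases hinit with ⟨h0, hw⟩ | ⟨rfl, h0, hv⟩
    · exact steersTo_of_profile h0 hw v₀ W hη
    · exact steersTo_of_velocity h0 hv W hη
  obtain ⟨l, hl, rfl, hnear⟩ :=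
    exists_listFlow_near hU waveControl_zero hreach (w₁, v₁) (half_pos hε) hT
  obtain ⟨W, hW, hend⟩ := exists_isMildSolution_listControl hU waveControl 0 l hl (w₀, v₀)
  obtain ⟨κ, hκ⟩ := exists_norm_listControl_le waveControl 0 l
  refine ⟨listControl 0 l, isPiecewiseConstant_listControl 0 l hl, W, isSolution_iff.mpr hW,
    fun W' hW' => (isSolution_iff.mp hW').eqOn hU hT.le hκ hW, ?_⟩
  calc stateNorm (W (listTime l) - (w₁, v₁)) ≤ 2 * ‖W (listTime l) - (w₁, v₁)‖ := stateNorm_le _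
    _ < ε := by
      rw [hend]
      linarith
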